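/- Let $n\ge 1$, $X_n=\{0,\dots,n-1\}$. An automaton $A=(X_n,Q_A,\pi_A)$ has a finite state set $Q_A$ and a transition function $\pi_A:X_n\times Q_A\to Q_A$, extended to words read from left to right. It is synchronizing at level $k$ if there is a map $\mathfrak s_k:X_n^k\to Q_A$ with $\pi_A(w,q)=\mathfrak s_k(w)$ for all $w\in X_n^k$, $q\in Q_A$; it is synchronizing if this holds for some $k$, and core if moreover every state is forced in this way by a word whose length is at least a synchronizing level. A folding of $A$ is an equivalence relation on $Q_A$ that is respected by all transitions, and gives the folded automaton $A/{\equiv}$. The underlying digraph $G_A$ has an edge $(q,x,\pi_A(x,q))$ for all $q\in Q_A$, $x\in X_n$ (parallel edges are distinct). A transducer is an automaton with an output function $\lambda_T:X_n\times Q_T\to X_n$, extended to words. States (of transducers over the same alphabet) are $\omega$-equivalent if they induce the same map on right-infinite words; $T$ is minimal if distinct states are not $\omega$-equivalent, and $\overline T$ denotes the minimal representative. Two minimal transducers are identified if there is a bijection of their states that matches $\omega$-equivalent states. A transducer $T$ that is synchronizing at level $k$ represents the map $f_T:X_n^{-\mathbb N}\to X_n^{-\mathbb N}$, $(x)f_T=y$,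 $y_i=\lambda_T(x_i,\mathfrak s_k(x_{i-k}\dots x_{i-1}))$. Let $\mathcal H_n\cong\mathrm{Aut}(X_n^{-\mathbb N},\sigma_n)$ be the group of minimal, core, invertible, synchronizing transducers $H$ over $X_n$ with $H^{-1}$ synchronizing, where the product is the product of transducers followed by removal of the non-core states and identification of $\omega$-equivalent states, and where $\sigma_n$ deletes the letter $x_0$ of $\dots x_{-2}x_{-1}x_0$. For a digraph automorphism $\psi$ of $G_A$ let $\mathscr H(A,\psi)$ be the transducer with underlying automaton $A$ and with $\lambda(x,q)$ the label of the image under $\psi$ of the edge leaving $q$ with label $x$. A synchronizing core automaton $A$ is a support of $H\in\mathcal H_n$, realised by $\psi$, if $H$ and $\mathscr H(A,\psi)$ represent the same map of $X_n^{-\mathbb N}$; it is a minimal support if no proper folding of $A$ is a support of $H$. For $H\in\mathcal H_n$ let $H^\vee_m$ be the $m$-th power of the dual of $H$: its alphabet is $Q_H$, its states are the words $w\in X_n^m$, and reading $q$ in state $w$ it writes $\pi_H(w,q)$ and moves to $\lambda_H(w,q)$. **Proposition.** Let $H\in\mathcal H_n$ have finite order. 1. There is a least $k\ge1$ such that $\overline{H^\vee_j}=\overline{H^\vee_k}$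 for all $j\ge k$. Writing $[\gamma]$ for the $\omega$-equivalence class of $\gamma\in X_n^k$ as a state of $H^\vee_k$, the rule $\pi(x,[\gamma_0\dots\gamma_{k-1}])=[\gamma_1\dots\gamma_{k-1}x]$ gives a well-defined automaton $A_H$ on the set of these classes. 2. There is a digraph automorphism $\phi_H$ of $G_{A_H}$ that, for every $\gamma\in X_n^k$, $p\in Q_H$ and $x\in X_n$, maps the vertex $[\gamma]$ to $[\lambda_H(\gamma,p)]$ and the edge leaving $[\gamma]$ with label $x$ to the edge leaving $[\lambda_H(\gamma,p)]$ with label $\lambda_H(x,\pi_H(\gamma,p))$. The automaton $A_H$ is a support of $H$, and $\phi_H$ is the one and only digraph automorphism of $G_{A_H}$ that realises it. 3. $A_H$ is a minimal support of $H$, every minimal support of $H$ is isomorphic, as an automaton, to $A_H$, and every support of $H$ has a folding isomorphic to $A_H$. 4. Every element of finite order of $\mathrm{Aut}(X_n^{-\mathbb N},\sigma_n)$ (the homeomorphisms that commute with $\sigma_n$) is $f_H$ for some $H\in\mathcal H_n$ of finite order, and there is a single algorithm (a partial recursive function) which, given $n$ and the tables of any finite synchronizing transducer $T$ over $X_n$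 with $f_T=f_H$ for an $H\in\mathcal H_n$ of finite order (for example $T=H$), halts and returns the tables of an automaton $A$ and a digraph automorphism $\psi$ such that some isomorphism of automata $A\to A_H$ carries $\psi$ to $\phi_H$. -/

import Mathlib

universe u v w

/-! Automata -/

/-- An automaton with alphabet `X` and state set `Q`; finiteness of `X` and `Q` is assumed where
automata are quantified over. -/
structure Automaton (X : Type u) (Q : Type v) where
  /-- `step x q` is the state reached from `q` by reading `x`. -/
  step : X → Q → Q

/-- The set `X^m` of words of length `m`. -/
abbrev Word (X : Type u) (m : ℕ) : Type u := List.Vector X m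

/-- The state reached from `q` by reading the letters of a word from left to right. -/
def Automaton.run {X : Type u} {Q : Type v} (A : Automaton X Q) : List X → Q → Q
  | [], q => q
  | x :: l, q => A.run l (A.step x q)

/-- `s` is the synchronizing map of `A` at level `k`. -/
def Automaton.IsSyncMap {X : Type u} {Q : Type v} (A : Automaton X Q) (k : ℕ)
    (s : Word X k → Q) : Prop :=
  ∀ (l : Word X k) (q : Q), A.run l.toList q = s l

/-- `A` is synchronizing at level `k`. -/
def Automaton.SyncAt {X : Type u} {Q : Type v} (A : Automaton X Q) (k : ℕ) : Prop :=
  ∃ s : Word X k → Q, A.IsSyncMap k s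

/-- `A` is synchronizing: all words of some fixed length are reset words. -/
def Automaton.IsSynchronizing {X : Type u} {Q : Type v} (A : Automaton X Q) : Prop :=
  ∃ k, A.SyncAt k

/-- `q` belongs to the core of `A`: it is forced by a word whose length is at least some
synchronizing level. -/
def Automaton.IsCoreState {X : Type u} {Q : Type v} (A : Automaton X Q) (q : Q) : Prop :=
  ∃ k, A.SyncAt k ∧ ∃ l : List X, k ≤ l.length ∧ ∀ p, A.run l p = q

/-- `A` is synchronizing and equal to its core. -/
def Automaton.IsSyncCore {X : Type u} {Q : Type v} (A : Automaton X Q) : Prop :=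
  A.IsSynchronizing ∧ ∀ q, A.IsCoreState q

/-- A folding of `A` is an equivalence relation on the states that is respected by reading. -/
def Automaton.IsFolding {X : Type u} {Q : Type v} (A : Automaton X Q) (r : Setoid Q) : Prop :=
  ∀ (x : X) (p q : Q), r p q → r (A.step x p) (A.step x q)

/-- The folded automaton. -/
def Automaton.fold {X : Type u} {Q : Type v} (A : Automaton X Q) (r : Setoid Q)
    (h : A.IsFolding r) : Automaton X (Quotient r) where
  step x := Quotient.map (A.step x) (fun p q hpq => h x p q hpq)

/-- Isomorphism of automata over the same alphabet. -/
def Automaton.Iso {X : Type u} {Q : Type v} {S : Type w} (A : Automaton X Q)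
    (B : Automaton X S) : Prop :=
  ∃ e : Q ≃ S, ∀ x q, e (A.step x q) = B.step x (e q)

/-- `B` is, up to isomorphism, a folding of `A`. -/
def Automaton.FoldsOnto {X : Type u} {Q : Type v} {S : Type w} (A : Automaton X Q)
    (B : Automaton X S) : Prop :=
  ∃ (r : Setoid Q) (h : A.IsFolding r), (A.fold r h).Iso B

/-- An automorphism of the underlying unlabelled digraph of `A`. The edge `(q, x, π(x, q))` is
written `(q, x)`; its source is `q` and its target is `π(x, q)`. Parallel edges are distinct. -/
@[ext]
structure DigraphAut {X : Type u} {Q : Type v} (A : Automaton X Q) where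
  vertex : Q ≃ Q
  edge : Q × X ≃ Q × X
  source_edge : ∀ q x, (edge (q, x)).1 = vertex q
  target_edge : ∀ q x, A.step (edge (q, x)).2 (edge (q, x)).1 = vertex (A.step x q)

/-! Transducers -/

/-- A (synchronous) transducer: an automaton with an output function. -/
structure Transducer (X : Type u) (Q : Type v) extends Automaton X Q where
  /-- `out x q` is the letter written when `x` is read in state `q`. -/
  out : X → Q → X

/-- The output of a finite word read from state `q`. -/
def Transducer.outWord {X : Type u} {Q : Type v} (T : Transducer X Q) : List X → Q → List X
  | [], _ => []
  | x :: l, q => T.out x q :: T.outWord l (T.step x q)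

theorem Transducer.length_outWord {X : Type u} {Q : Type v} (T : Transducer X Q) (l : List X)
    (q : Q) : (T.outWord l q).length = l.length := by
  induction l generalizing q with
  | nil => rfl
  | cons x l ih => simp [Transducer.outWord, ih]

/-- The state after reading the first `i` letters of the infinite word `x` from `q`. -/
def Transducer.stateAt {X : Type u} {Q : Type v} (T : Transducer X Q) (q : Q) (x : ℕ → X) : ℕ → Q
  | 0 => q
  | i + 1 => T.step (x i) (T.stateAt q x i)

/-- The map on right-infinite words induced by the state `q`. -/
def Transducer.omegaMap {X : Type u} {Q : Type v} (T : Transducer X Q) (q : Q) (x : ℕ → X) :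
    ℕ → X :=
  fun i => T.out (x i) (T.stateAt q x i)

/-- The `ω`-equivalence of states of two transducers over the same alphabet. -/
def OmegaEquiv {X : Type u} {Q : Type v} {S : Type w} (T : Transducer X Q) (p : Q)
    (U : Transducer X S) (q : S) : Prop :=
  T.omegaMap p = U.omegaMap q

/-- No two distinct states are `ω`-equivalent. -/
def Transducer.IsMinimal {X : Type u} {Q : Type v} (T : Transducer X Q) : Prop :=
  ∀ p q, OmegaEquiv T p T q → p = q

/-- The equivalence relation of `ω`-equivalence on the states of `T`. -/
def Transducer.omegaSetoid {X : Type u} {Q : Type v} (T : Transducer X Q) : Setoid Q where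
  r p q := OmegaEquiv T p T q
  iseqv := ⟨fun _ => rfl, fun h => h.symm, fun h h' => h.trans h'⟩

theorem Transducer.omegaMap_cons {X : Type u} {Q : Type v} (T : Transducer X Q) (q : Q) (a : X)
    (x : ℕ → X) :
    T.omegaMap q (fun i => Nat.casesOn i a x) =
      fun i => Nat.casesOn i (T.out a q) (T.omegaMap (T.step a q) x) := by
  have key : ∀ i, T.stateAt q (fun i => Nat.casesOn i a x) (i + 1)
      = T.stateAt (T.step a q) x i := by
    intro i
    induction i with
    | zero => rfl
    | succ i ih => rw [Transducer.stateAt, ih]; rfl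
  funext i
  cases i with
  | zero => rfl
  | succ i => simp only [Transducer.omegaMap, key]

theorem Transducer.omegaEquiv_step {X : Type u} {Q : Type v} (T : Transducer X Q) (a : X) (p q : Q)
    (h : OmegaEquiv T p T q) : OmegaEquiv T (T.step a p) T (T.step a q) := by
  funext x i
  have := congrFun (congrFun h (fun i => Nat.casesOn i a x)) (i + 1)
  rw [T.omegaMap_cons, T.omegaMap_cons] at this
  exact this

theorem Transducer.omegaEquiv_out {X : Type u} {Q : Type v} (T : Transducer X Q) (a : X) (p q : Q)
    (h : OmegaEquiv T p T q) : T.out a p = T.out a q :=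
  congrFun (congrFun h (fun _ => a)) 0

/-- The minimal representative of `T`: its `ω`-equivalent states are identified. -/
def Transducer.minRep {X : Type u} {Q : Type v} (T : Transducer X Q) :
    Transducer X (Quotient T.omegaSetoid) where
  step a := Quotient.map (T.step a) (fun p q h => T.omegaEquiv_step a p q h)
  out a := Quotient.lift (T.out a) (fun p q h => T.omegaEquiv_out a p q h)

/-- The `ω`-equality of minimal transducers: a bijection between the states that matches each
state with an `ω`-equivalent one. -/
def OmegaEq {X : Type u} {Q : Type v} {S : Type w} (T : Transducer X Q) (U : Transducer X S) :
    Prop :=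
  ∃ f : Q ≃ S, ∀ q, OmegaEquiv T q U (f q)

/-- Every state induces a permutation of the alphabet. -/
def Transducer.IsInvertible {X : Type u} {Q : Type v} (T : Transducer X Q) : Prop :=
  ∀ q, Function.Bijective (fun x => T.out x q)

/-- The inverse of an invertible transducer (the state `q⁻¹` is written `q`). -/
noncomputable def Transducer.inverse {X : Type u} {Q : Type v} (T : Transducer X Q)
    (h : T.IsInvertible) : Transducer X Q where
  step x q := T.step ((Equiv.ofBijective _ (h q)).symm x) q
  out x q := (Equiv.ofBijective _ (h q)).symm x

/-- The product: the output of `T` is the input of `U`. -/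
def Transducer.prod {X : Type u} {Q : Type v} {S : Type w} (T : Transducer X Q)
    (U : Transducer X S) : Transducer X (Q × S) where
  step x q := (T.step x q.1, U.step (T.out x q.1) q.2)
  out x q := U.out (T.out x q.1) q.2

/-- The one-state transducer that copies its input. -/
def Transducer.identity (X : Type u) : Transducer X PUnit.{v + 1} where
  step _ q := q
  out x _ := x

/-- The states of the `m`-fold product. -/
def PowState (Q : Type v) : ℕ → Type v
  | 0 => PUnit
  | m + 1 => PowState Q m × Q

/-- The `m`-fold product of `T` with itself. -/
def Transducer.pow {X : Type u} {Q : Type v} (T : Transducer X Q) :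
    (m : ℕ) → Transducer X (PowState Q m)
  | 0 => Transducer.identity X
  | m + 1 => (T.pow m).prod T

/-- `T` is a minimal, core, invertible, bi-synchronizing transducer over `{0, …, n - 1}`, that is,
an element of the group `H_n`. -/
structure IsHn {n : ℕ} {Q : Type v} (T : Transducer (Fin n) Q) : Prop where
  invertible : T.IsInvertible
  minimal : T.IsMinimal
  syncCore : T.toAutomaton.IsSyncCore
  inverse_sync : (T.inverse invertible).toAutomaton.IsSynchronizing

/-- `T` has finite order in `H_n`: for some `m ≥ 1`, removing the non-core states of the `m`-fold
product and identifying `ω`-equivalent states leaves the identity transducer. -/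
def Transducer.FiniteOrder {X : Type u} {Q : Type v} (T : Transducer X Q) : Prop :=
  ∃ m, 1 ≤ m ∧ (T.pow m).toAutomaton.IsSynchronizing ∧
    ∀ q, (T.pow m).toAutomaton.IsCoreState q →
      OmegaEquiv (T.pow m) q (Transducer.identity.{u, 0} X) PUnit.unit

/-! The shift space. A left-infinite sequence `… x₋₂ x₋₁ x₀` is the function `i ↦ x₋ᵢ` on `ℕ`. -/

/-- The shift map deletes `x₀`. -/
def shiftMap {X : Type u} (x : ℕ → X) : ℕ → X := fun i => x (i + 1)

/-- The `k` letters `x₋ᵢ₋ₖ … x₋ᵢ₋₁` that precede position `-i`. -/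
def pastWord {X : Type u} (x : ℕ → X) (i k : ℕ) : Word X k :=
  List.Vector.ofFn (fun j : Fin k => x (i + k - j))

/-- `T` is synchronizing and `F` is the transformation `f_T` of the shift space it represents. -/
def Transducer.Induces {X : Type u} {Q : Type v} (T : Transducer X Q)
    (F : (ℕ → X) → (ℕ → X)) : Prop :=
  ∃ (k : ℕ) (s : Word X k → Q), T.toAutomaton.IsSyncMap k s ∧
    ∀ x i, F x i = T.out (x i) (s (pastWord x i k))

/-- `T` and `U` represent the same transformation of the shift space. -/
def SameMap {X : Type u} {Q : Type v} {S : Type w} (T : Transducer X Q) (U : Transducer X S) :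
    Prop :=
  ∃ F, T.Induces F ∧ U.Induces F

/-! Supports -/

/-- The transducer obtained by gluing `A` to a copy of itself along the digraph automorphism `ψ`:
the edge `(q, x)` writes the label of its image. -/
def DigraphAut.transducer {X : Type u} {Q : Type v} {A : Automaton X Q} (ψ : DigraphAut A) :
    Transducer X Q where
  step := A.step
  out x q := (ψ.edge (q, x)).2

/-- `A` is synchronizing and core, and `H` is induced from `(A, ψ)`. -/
def InducedFrom {X : Type u} {Q : Type v} {S : Type w} (H : Transducer X Q) {A : Automaton X S}
    (ψ : DigraphAut A) : Prop :=
  A.IsSyncCore ∧ SameMap H ψ.transducer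

/-- `A` is a support of `H`. -/
def Supports {X : Type u} {Q : Type v} {S : Type w} (A : Automaton X S) (H : Transducer X Q) :
    Prop :=
  ∃ ψ : DigraphAut A, InducedFrom H ψ

/-- `A` is a support of `H` and no proper folding of `A` is. -/
def IsMinimalSupport {X : Type u} {Q : Type v} {S : Type w} (A : Automaton X S)
    (H : Transducer X Q) : Prop :=
  Supports A H ∧ ∀ (r : Setoid S) (h : A.IsFolding r), Supports (A.fold r h) H → r = ⊥

/-! The dual transducer and the automaton built from the zero of the semigroup of its powers -/

/-- The transducer `T(m)`, which reads words of length `m` as letters. -/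
def Transducer.blocks {X : Type u} {Q : Type v} (T : Transducer X Q) (m : ℕ) :
    Transducer (Word X m) Q where
  step l q := T.run l.toList q
  out l q := ⟨T.outWord l.toList q, by rw [T.length_outWord]; exact l.toList_length⟩

/-- The dual transducer: states and letters are exchanged. -/
def Transducer.dual {X : Type u} {Q : Type v} (T : Transducer X Q) : Transducer Q X where
  step q x := T.out x q
  out q x := T.step x q

/-- The `m`-th power of the dual of `T`, as the dual of `T(m)`. -/
def Transducer.dualPow {X : Type u} {Q : Type v} (T : Transducer X Q) (m : ℕ) :
    Transducer Q (Word X m) :=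
  (T.blocks m).dual

/-- The minimal representative of the `k`-th power of the dual is the zero of the semigroup of
minimal representatives of powers of the dual: all later powers agree with it. -/
def Transducer.IsZeroLevel {X : Type u} {Q : Type v} (T : Transducer X Q) (k : ℕ) : Prop :=
  1 ≤ k ∧ ∀ j, k ≤ j → OmegaEq (T.dualPow j).minRep (T.dualPow k).minRep

/-- The least `k` at which the zero is reached. -/
noncomputable def Transducer.zeroLevel {X : Type u} {Q : Type v} (T : Transducer X Q) : ℕ :=
  sInf {k | T.IsZeroLevel k}

/-- The states of the zero: the classes `[γ]` of words `γ` of length `k`. -/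
noncomputable def Transducer.DualState {X : Type u} {Q : Type v} (T : Transducer X Q) : Type u :=
  Quotient (T.dualPow T.zeroLevel).omegaSetoid

/-- The class `[γ]`. -/
noncomputable def Transducer.cls {X : Type u} {Q : Type v} (T : Transducer X Q) (γ : Word X T.zeroLevel) :
    T.DualState :=
  Quotient.mk (T.dualPow T.zeroLevel).omegaSetoid γ

/-- Append `x` to `γ` and delete the first letter. -/
def Word.push {X : Type u} {m : ℕ} (γ : Word X m) (x : X) : Word X m :=
  ⟨(γ.toList ++ [x]).tail, by simp⟩

/-- The automaton `A_T`: from `[γ]`, reading `x` leads to the class of `γ` with `x` appended and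
its first letter deleted. Here some representative of the class is used; that every
representative gives the same result is stated where the automaton is used. -/
noncomputable def Transducer.dualAutomaton {X : Type u} {Q : Type v} (T : Transducer X Q) :
    Automaton X T.DualState where
  step x c := T.cls (Word.push (Quotient.out c) x)

/-- `φ` is the digraph automorphism by which `T` acts on `A_T`: with any initial state `p`, the
vertex `[γ]` goes to `[λ(γ, p)]`, and the edge leaving `[γ]` with label `x` goes to the edge
leaving `[λ(γ, p)]` with label `λ(x, π(γ, p))`. -/
def Transducer.IsDualAction {X : Type u} {Q : Type v} (T : Transducer X Q)
    (φ : DigraphAut T.dualAutomaton) : Prop :=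
  ∀ (γ : Word X T.zeroLevel) (p : Q),
    φ.vertex (T.cls γ) = T.cls ((T.blocks T.zeroLevel).out γ p) ∧
    ∀ x, φ.edge (T.cls γ, x) =
      (T.cls ((T.blocks T.zeroLevel).out γ p), T.out x (T.run γ.toList p))

/-- An isomorphism of automata that carries `ψ` to `φ`. -/
def DigraphAut.Iso {X : Type u} {Q : Type v} {S : Type w} {A : Automaton X Q} {B : Automaton X S}
    (ψ : DigraphAut A) (φ : DigraphAut B) : Prop :=
  ∃ e : Q ≃ S, (∀ x q, e (A.step x q) = B.step x (e q)) ∧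
    (∀ q, e (ψ.vertex q) = φ.vertex (e q)) ∧
    ∀ q x, φ.edge (e q, x) = (e (ψ.edge (q, x)).1, (ψ.edge (q, x)).2)

/-! Finite data, for effectiveness -/

/-- A transducer with `m` states over `n` letters as finite data: `n`, `m`, and the tables of the
transition and output functions, with one row for each state. -/
def Transducer.code {n m : ℕ} (T : Transducer (Fin n) (Fin m)) :
    ℕ × ℕ × List (List ℕ) × List (List ℕ) :=
  (n, m, List.ofFn (fun q => List.ofFn (fun x => (T.step x q : ℕ))),
    List.ofFn (fun q => List.ofFn (fun x => (T.out x q : ℕ))))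

/-- An automaton with a digraph automorphism as finite data: the transition table, the table of
the labels of the images of the edges, and the list of the images of the vertices. -/
def DigraphAut.code {n m : ℕ} {A : Automaton (Fin n) (Fin m)} (ψ : DigraphAut A) :
    (ℕ × ℕ × List (List ℕ) × List (List ℕ)) × List ℕ :=
  (ψ.transducer.code, List.ofFn (fun q => (ψ.vertex q : ℕ)))

/-! Left-infinite sequences -/

/-! Let `F` be the map represented by `H`. Chain infinitely many copies of `H`, each reading what
the previous one writes. The resulting automaton `infPow` has states `ℕ → Q`, and a word `γ`, as a
state of a dual power, transforms `ℕ → Q` exactly as reading `γ` does in `infPow`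
(`dualPow_omegaMap`). If `F^N = id`, the iterates of `F` have a common memory, so all long words
reset every coordinate at once (`exists_infPow_run_appendSeq`). The levels at which the zero is
reached are then the positive synchronizing levels of `infPow`, and `A_H` is its core
(`dualEmbedding`). The past `x` leads there to the sequence of states that `x`, `F x`, `F² x`, …
reach in `H`. Hence applying `F` shifts this sequence; the shift is `φ_H`, and it is invertible
because the sequences have period `N` (`exists_dualAction`).

For a support `A` realised by `ψ`, minimality of `H` gives an output-preserving homomorphism `u`
from `A` to `H`. The map sending `a` to the sequence `u (ψ^t a)` is a homomorphism to `infPow`; a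
core goes onto the core, so `A` maps onto `A_H` and `ψ` goes to `φ_H` (`InducedFrom.exists_isHom`).
Homomorphisms out of a synchronizing core automaton into a synchronizing one are unique
(`hom_unique`). Uniqueness of `φ_H` and minimality of `A_H` follow, and the kernel of the map from
`A` is the required folding.

An automorphism of the shift has finite memory by compactness, and the maps it induces on
continuations of pasts are the states of its minimal transducer (`HasMemory.exists_transducer`).

The algorithm is an unbounded search for tables of a support, accompanied by rank functions
certifying that it is synchronizing, represents the right map and cannot be folded further. Checking
is primitive recursive (`primrecPred_isCertificate`), a certificate exists (`exists_isCertificate`),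
and each one describes `A_H` with `φ_H` (`IsCertificate.exists_iso`). -/

/-- Append the letter `a` to a left-infinite sequence. -/
def pushSeq {X : Type u} (x : ℕ → X) (a : X) : ℕ → X := fun i => Nat.casesOn i a x

/-- Append a finite word to a left-infinite sequence. -/
def appendSeq {X : Type u} (x : ℕ → X) (l : List X) : ℕ → X := l.foldl pushSeq x

/-- The last `k` letters of a left-infinite sequence. -/
def pastList {X : Type u} (x : ℕ → X) : ℕ → List X
  | 0 => []
  | k + 1 => x k :: pastList x k

/-- The last `j` letters of two left-infinite sequences agree. -/
def Agree {X : Type u} (j : ℕ) (x y : ℕ → X) : Prop := ∀ i < j, x i = y i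

section Sequences

variable {X : Type u}

theorem Agree.mono {i j : ℕ} {x y : ℕ → X} (h : Agree j x y) (hij : i ≤ j) : Agree i x y :=
  fun t ht => h t (ht.trans_le hij)

theorem Agree.trans {j : ℕ} {x y z : ℕ → X} (h : Agree j x y) (h' : Agree j y z) : Agree j x z :=
  fun t ht => (h t ht).trans (h' t ht)

theorem pushSeq_shiftMap (x : ℕ → X) : pushSeq (shiftMap x) (x 0) = x := by
  funext i; cases i <;> rfl

theorem pushSeq_ext {x y : ℕ → X} (h0 : x 0 = y 0) (h : shiftMap x = shiftMap y) : x = y := by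
  rw [← pushSeq_shiftMap x, ← pushSeq_shiftMap y, h0, h]

theorem shiftMap_iterate (x : ℕ → X) (j : ℕ) : shiftMap^[j] x = fun i => x (i + j) := by
  induction j generalizing x with
  | zero => rfl
  | succ j ih =>
    rw [Function.iterate_succ_apply, ih]
    rfl

@[simp] theorem appendSeq_cons (x : ℕ → X) (a : X) (l : List X) :
    appendSeq x (a :: l) = appendSeq (pushSeq x a) l := rfl

theorem appendSeq_append (x : ℕ → X) (l m : List X) :
    appendSeq x (l ++ m) = appendSeq (appendSeq x l) m := List.foldl_append

theorem Agree.pushSeq {j : ℕ} {x y : ℕ → X} (h : Agree j x y) (a : X) :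
    Agree (j + 1) (pushSeq x a) (pushSeq y a) := by
  rintro (_ | i) hi
  · rfl
  · exact h i (by omega)

theorem Agree.appendSeq {j : ℕ} {x y : ℕ → X} (h : Agree j x y) (l : List X) :
    Agree (j + l.length) (appendSeq x l) (appendSeq y l) := by
  induction l generalizing j x y with
  | nil => exact h
  | cons a l ih => exact (ih (h.pushSeq a)).mono (by simp; omega)

theorem agree_appendSeq (x y : ℕ → X) (l : List X) :
    Agree l.length (appendSeq x l) (appendSeq y l) :=
  ((show Agree 0 x y from fun i hi => absurd hi i.not_lt_zero).appendSeq l).mono (by omega)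

@[simp] theorem length_pastList (x : ℕ → X) (k : ℕ) : (pastList x k).length = k := by
  induction k with
  | zero => rfl
  | succ k ih => simp [pastList, ih]

theorem pastList_congr {k : ℕ} {x y : ℕ → X} (h : Agree k x y) : pastList x k = pastList y k := by
  induction k with
  | zero => rfl
  | succ k ih => rw [pastList, pastList, h k (by omega), ih (h.mono (by omega))]

theorem pastList_pushSeq (x : ℕ → X) (a : X) (k : ℕ) :
    pastList (pushSeq x a) (k + 1) = pastList x k ++ [a] := by
  induction k with
  | zero => rfl
  | succ k ih => rw [pastList, ih]; rfl

theorem pastList_succ (x : ℕ → X) (k : ℕ) :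
    pastList x (k + 1) = pastList (shiftMap x) k ++ [x 0] := by
  rw [← pastList_pushSeq, pushSeq_shiftMap]

theorem pastList_add (x : ℕ → X) (j k : ℕ) :
    pastList x (j + k) = pastList (shiftMap^[k] x) j ++ pastList x k := by
  induction j with
  | zero => simp [pastList]
  | succ j ih =>
    rw [show j + 1 + k = (j + k) + 1 by omega, pastList, ih, pastList, shiftMap_iterate]; rfl

theorem pastList_appendSeq (x : ℕ → X) (l : List X) :
    pastList (appendSeq x l) l.length = l := by
  induction l using List.reverseRecOn generalizing x with
  | nil => rfl
  | append_singleton l a ih =>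
    rw [appendSeq_append, List.length_append, List.length_singleton]
    show pastList (pushSeq (appendSeq x l) a) _ = _
    rw [pastList_pushSeq, ih]

theorem appendSeq_pastList (x : ℕ → X) (k : ℕ) :
    appendSeq (shiftMap^[k] x) (pastList x k) = x := by
  induction k generalizing x with
  | zero => rfl
  | succ k ih =>
    rw [Function.iterate_succ_apply, pastList_succ, appendSeq_append, ih]
    exact pushSeq_shiftMap x

theorem toList_pastWord (x : ℕ → X) (i k : ℕ) :
    (pastWord x i k).toList = pastList (shiftMap^[i + 1] x) k := by
  rw [shiftMap_iterate]
  induction k with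
  | zero => simp [pastWord, pastList]
  | succ k ih =>
    rw [pastWord, List.Vector.toList_ofFn] at ih ⊢
    rw [List.ofFn_succ, pastList, ← ih]
    congr 1
    · congr 1; simp; omega
    · congr 1; funext j; congr 1; simp; omega

theorem map_iterate_shiftMap {F : (ℕ → X) → (ℕ → X)} (hF : ∀ x, F (shiftMap x) = shiftMap (F x))
    (x : ℕ → X) (j : ℕ) : F (shiftMap^[j] x) = shiftMap^[j] (F x) := by
  induction j generalizing x with
  | zero => rfl
  | succ j ih => rw [Function.iterate_succ_apply, ih, hF, ← Function.iterate_succ_apply]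

/-- `F` has memory `k`: the last letter of `F x` depends only on the last `k + 1` of `x`. -/
def HasMemory (F : (ℕ → X) → (ℕ → X)) (k : ℕ) : Prop :=
  ∀ j x y, Agree (j + k) x y → Agree j (F x) (F y)

theorem HasMemory.mono {F : (ℕ → X) → (ℕ → X)} {k m : ℕ} (h : HasMemory F k) (hkm : k ≤ m) :
    HasMemory F m := fun j x y hxy => h j x y (hxy.mono (by omega))

theorem HasMemory.iterate {F : (ℕ → X) → (ℕ → X)} {k : ℕ} (h : HasMemory F k) (t : ℕ) :
    HasMemory F^[t] (t * k) := by
  induction t with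
  | zero => intro j x y hxy; simpa using hxy
  | succ t ih =>
    intro j x y hxy
    rw [Function.iterate_succ_apply, Function.iterate_succ_apply]
    exact ih j _ _ (h _ _ _ (hxy.mono (by rw [Nat.succ_mul]; omega)))

theorem hasMemory_of_zero {F : (ℕ → X) → (ℕ → X)} (hF : ∀ x, F (shiftMap x) = shiftMap (F x))
    {k : ℕ} (h : ∀ x y, Agree k x y → F x 0 = F y 0) : HasMemory F k := by
  intro j x y hxy i hi
  have := h (shiftMap^[i] x) (shiftMap^[i] y) (fun t ht => by
    rw [shiftMap_iterate, shiftMap_iterate]; exact hxy _ (by omega))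
  rw [map_iterate_shiftMap hF, map_iterate_shiftMap hF, shiftMap_iterate, shiftMap_iterate] at this
  simpa using this

theorem iterate_mod_of_iterate_eq_id {F : X → X} {N : ℕ} (hN : F^[N] = id) (t : ℕ) :
    F^[t] = F^[t % N] := by
  conv_lhs => rw [← Nat.mod_add_div t N, Function.iterate_add, Function.iterate_mul, hN,
    Function.iterate_id, Function.comp_id]

/-- Only exponents below `N` matter, so the bound does not grow with `t`. This uniformity is what
finite order contributes to the synchronization of the infinite power. -/
theorem HasMemory.iterate_of_periodic {F : (ℕ → X) → (ℕ → X)} {k N : ℕ} (h : HasMemory F k)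
    (hN : 1 ≤ N) (hF : F^[N] = id) (t : ℕ) : HasMemory F^[t] (N * k) := by
  rw [iterate_mod_of_iterate_eq_id hF t]
  exact (h.iterate _).mono (Nat.mul_le_mul_right k (Nat.mod_lt t hN).le)

end Sequences

/-! The state of a synchronizing automaton after reading a left-infinite sequence -/

section PastState

variable {X : Type u} {Q : Type v} {S : Type w}

theorem Automaton.run_append (A : Automaton X Q) (l m : List X) (q : Q) :
    A.run (l ++ m) q = A.run m (A.run l q) := by
  induction l generalizing q with
  | nil => rfl
  | cons a l ih => exact ih _

/-- The state reached after reading the left-infinite sequence `x`. -/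
noncomputable def Automaton.pastState {A : Automaton X Q} (h : A.IsSynchronizing) (x : ℕ → X) : Q :=
  h.choose_spec.choose ⟨pastList x h.choose, length_pastList x _⟩

/-- Frees later arguments from the level chosen in the definition of `pastState`: letters read
before a resetting word are forgotten. -/
theorem Automaton.exists_run_pastList {A : Automaton X Q} (h : A.IsSynchronizing) :
    ∃ K, ∀ k, K ≤ k → ∀ x q, A.run (pastList x k) q = A.pastState h x := by
  refine ⟨h.choose, fun k hk x q => ?_⟩
  obtain ⟨j, rfl⟩ := Nat.exists_eq_add_of_le' hk
  rw [pastList_add, Automaton.run_append]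
  exact h.choose_spec.choose_spec ⟨pastList x h.choose, length_pastList x _⟩ _

theorem Automaton.run_pastList {A : Automaton X Q} (h : A.IsSynchronizing) {k : ℕ}
    (hk : ∀ l : List X, l.length = k → ∀ p q, A.run l p = A.run l q) (x : ℕ → X) (q : Q) :
    A.run (pastList x k) q = A.pastState h x := by
  obtain ⟨K, hK⟩ := A.exists_run_pastList h
  rw [← hK (K + k) (by omega) x q, pastList_add, Automaton.run_append]
  exact hk _ (length_pastList _ _) _ _

theorem Automaton.SyncAt.run_eq {A : Automaton X Q} {k : ℕ} (h : A.SyncAt k) (l : List X)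
    (hl : k ≤ l.length) (p q : Q) : A.run l p = A.run l q := by
  obtain ⟨s, hs⟩ := h
  rw [← List.take_append_drop (l.length - k) l, Automaton.run_append, Automaton.run_append]
  have hd : (l.drop (l.length - k)).length = k := by rw [List.length_drop]; omega
  exact (hs ⟨_, hd⟩ _).trans (hs ⟨_, hd⟩ _).symm

theorem Automaton.syncAt_of_run_eq {A : Automaton X Q} [Nonempty Q] {k : ℕ}
    (hk : ∀ l : List X, l.length = k → ∀ p q, A.run l p = A.run l q) : A.SyncAt k :=
  ⟨fun l => A.run l.toList (Classical.arbitrary Q), fun l _ => hk _ l.toList_length _ _⟩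

theorem Automaton.nonempty_of_isSynchronizing [Nonempty X] {A : Automaton X Q}
    (h : A.IsSynchronizing) : Nonempty Q :=
  ⟨A.pastState h fun _ => Classical.arbitrary X⟩

theorem Automaton.syncAt_of_run_pastList [Nonempty X] {A : Automaton X Q} {σ : (ℕ → X) → Q} {k : ℕ}
    (h : ∀ x q, A.run (pastList x k) q = σ x) : A.SyncAt k := by
  have x₀ : ℕ → X := fun _ => Classical.arbitrary X
  refine ⟨fun l => σ (appendSeq x₀ l.toList), fun l q => ?_⟩
  have := h (appendSeq x₀ l.toList) q
  have e := pastList_appendSeq x₀ l.toList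
  rw [l.toList_length] at e
  rwa [e] at this

theorem Automaton.pastState_eq_of_run_pastList {A : Automaton X Q} (h : A.IsSynchronizing)
    {σ : (ℕ → X) → Q} {k : ℕ} (hk : ∀ x q, A.run (pastList x k) q = σ x) : A.pastState h = σ := by
  obtain ⟨K, hK⟩ := A.exists_run_pastList h
  funext x
  rw [← hK (K + k) (by omega) x (A.pastState h x), pastList_add, Automaton.run_append, hk]

theorem Automaton.pastState_pushSeq {A : Automaton X Q} (h : A.IsSynchronizing) (x : ℕ → X)
    (a : X) : A.pastState h (pushSeq x a) = A.step a (A.pastState h x) := by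
  obtain ⟨K, hK⟩ := A.exists_run_pastList h
  rw [← hK (K + 1) (by omega) _ (A.pastState h x), pastList_pushSeq, Automaton.run_append,
    hK K le_rfl]
  rfl

theorem Automaton.pastState_appendSeq {A : Automaton X Q} (h : A.IsSynchronizing) (x : ℕ → X)
    (l : List X) : A.pastState h (appendSeq x l) = A.run l (A.pastState h x) := by
  induction l generalizing x with
  | nil => rfl
  | cons a l ih => rw [appendSeq_cons, ih, Automaton.pastState_pushSeq]; rfl

theorem Automaton.exists_pastState_congr {A : Automaton X Q} (h : A.IsSynchronizing) :
    ∃ K, ∀ x y, Agree K x y → A.pastState h x = A.pastState h y := by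
  obtain ⟨K, hK⟩ := A.exists_run_pastList h
  refine ⟨K, fun x y hxy => ?_⟩
  rw [← hK K le_rfl x (A.pastState h x), pastList_congr hxy, hK K le_rfl]

/-- A forcing word can be preceded by any left-infinite sequence, and a long enough tail of a past
is a forcing word. Being core thus becomes surjectivity of `pastState`. -/
theorem Automaton.isCoreState_iff [Nonempty X] {A : Automaton X Q} (h : A.IsSynchronizing) (q : Q) :
    A.IsCoreState q ↔ ∃ x, A.pastState h x = q := by
  constructor
  · rintro ⟨k, -, l, -, hl⟩
    refine ⟨appendSeq (fun _ => Classical.arbitrary X) l, ?_⟩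
    rw [Automaton.pastState_appendSeq, hl]
  · rintro ⟨x, rfl⟩
    obtain ⟨K, hK⟩ := A.exists_run_pastList h
    exact ⟨K, Automaton.syncAt_of_run_pastList (hK K le_rfl), pastList x K, by simp,
      hK K le_rfl x⟩

theorem Automaton.IsSyncCore.isSynchronizing {A : Automaton X Q} (h : A.IsSyncCore) :
    A.IsSynchronizing := h.1

theorem Automaton.isSyncCore_iff [Nonempty X] {A : Automaton X Q} (h : A.IsSynchronizing) :
    A.IsSyncCore ↔ Function.Surjective (A.pastState h) :=
  ⟨fun hA q => (Automaton.isCoreState_iff h q).1 (hA.2 q),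
    fun hs => ⟨h, fun q => (Automaton.isCoreState_iff h q).2 (hs q)⟩⟩

/-! Homomorphisms -/

theorem Automaton.run_map {A : Automaton X Q} {B : Automaton X S} {g : Q → S}
    (hg : ∀ x q, g (A.step x q) = B.step x (g q)) (l : List X) (q : Q) :
    g (A.run l q) = B.run l (g q) := by
  induction l generalizing q with
  | nil => rfl
  | cons a l ih => rw [Automaton.run, ih, hg]; rfl

theorem Automaton.pastState_map {A : Automaton X Q} {B : Automaton X S} {g : Q → S}
    (hg : ∀ x q, g (A.step x q) = B.step x (g q)) (hA : A.IsSynchronizing)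
    (hB : B.IsSynchronizing) (x : ℕ → X) : g (A.pastState hA x) = B.pastState hB x := by
  obtain ⟨K, hK⟩ := A.exists_run_pastList hA
  obtain ⟨L, hL⟩ := B.exists_run_pastList hB
  rw [← hK (K + L) (by omega) x (A.pastState hA x), Automaton.run_map hg, hL _ (by omega)]

theorem Automaton.isSyncCore_of_surjective [Nonempty X] {A : Automaton X Q} {B : Automaton X S}
    {g : Q → S} (hg : ∀ x q, g (A.step x q) = B.step x (g q)) (hs : Function.Surjective g)
    (hA : A.IsSyncCore) : B.IsSyncCore := by
  obtain ⟨K, hK⟩ := A.exists_run_pastList hA.isSynchronizing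
  have hB : B.IsSynchronizing := by
    refine ⟨K, Automaton.syncAt_of_run_pastList (σ := fun x => g (A.pastState hA.isSynchronizing x)) ?_⟩
    intro x q
    obtain ⟨p, rfl⟩ := hs q
    rw [← Automaton.run_map hg, hK K le_rfl]
  rw [Automaton.isSyncCore_iff hB]
  intro q
  obtain ⟨p, rfl⟩ := hs q
  obtain ⟨x, rfl⟩ := (Automaton.isSyncCore_iff hA.isSynchronizing).1 hA p
  exact ⟨x, (Automaton.pastState_map hg hA.isSynchronizing hB x).symm⟩

end PastState

/-! The map represented by a synchronizing transducer -/

section MapOf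

variable {X : Type u} {Q : Type v} {S : Type w}

/-- The transformation of the shift space represented by a synchronizing transducer. -/
noncomputable def Transducer.mapOf (T : Transducer X Q) (h : T.toAutomaton.IsSynchronizing)
    (x : ℕ → X) : ℕ → X :=
  fun i => T.out (x i) (T.pastState h (shiftMap^[i + 1] x))

/-- The represented map does not depend on the level and the synchronizing map that witness it. -/
theorem Transducer.induces_iff {T : Transducer X Q} {F : (ℕ → X) → (ℕ → X)} :
    T.Induces F ↔ ∃ h : T.toAutomaton.IsSynchronizing, F = T.mapOf h := by
  constructor
  · rintro ⟨k, s, hs, hF⟩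
    have h : T.toAutomaton.IsSynchronizing := ⟨k, s, hs⟩
    refine ⟨h, ?_⟩
    funext x i
    rw [hF]
    show _ = T.out _ _
    congr 1
    rw [← Automaton.run_pastList _ (fun l hl => Automaton.SyncAt.run_eq ⟨s, hs⟩ l hl.ge) _
      (s (pastWord x i k)), ← toList_pastWord]
    exact (hs _ _).symm
  · rintro ⟨h, rfl⟩
    refine ⟨h.choose, h.choose_spec.choose, h.choose_spec.choose_spec, fun x i => ?_⟩
    show T.out _ (Automaton.pastState h _) = _
    rw [Automaton.pastState]
    congr 1
    refine congrArg _ (Subtype.ext ?_)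
    exact (toList_pastWord x i _).symm

theorem sameMap_iff {T : Transducer X Q} {U : Transducer X S} :
    SameMap T U ↔ ∃ (hT : T.toAutomaton.IsSynchronizing) (hU : U.toAutomaton.IsSynchronizing),
      T.mapOf hT = U.mapOf hU := by
  simp only [SameMap, Transducer.induces_iff]
  constructor
  · rintro ⟨F, ⟨hT, rfl⟩, hU, h⟩; exact ⟨hT, hU, h⟩
  · rintro ⟨hT, hU, h⟩; exact ⟨_, ⟨hT, rfl⟩, hU, h⟩

variable {T : Transducer X Q} (h : T.toAutomaton.IsSynchronizing)

theorem Transducer.mapOf_shiftMap (x : ℕ → X) : T.mapOf h (shiftMap x) = shiftMap (T.mapOf h x) :=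
  rfl

theorem Transducer.mapOf_zero (x : ℕ → X) :
    T.mapOf h x 0 = T.out (x 0) (T.pastState h (shiftMap x)) := rfl

theorem Transducer.mapOf_pushSeq (x : ℕ → X) (a : X) :
    T.mapOf h (pushSeq x a) = pushSeq (T.mapOf h x) (T.out a (T.pastState h x)) :=
  pushSeq_ext rfl rfl

theorem Transducer.mapOf_appendSeq (x : ℕ → X) (l : List X) :
    T.mapOf h (appendSeq x l) = appendSeq (T.mapOf h x) (T.outWord l (T.pastState h x)) := by
  induction l generalizing x with
  | nil => rfl
  | cons a l ih =>
    rw [appendSeq_cons, ih, Transducer.mapOf_pushSeq, Automaton.pastState_pushSeq]; rfl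

theorem Transducer.outWord_pastList (x : ℕ → X) (k : ℕ) :
    T.outWord (pastList x k) (T.pastState h (shiftMap^[k] x)) = pastList (T.mapOf h x) k := by
  have := T.mapOf_appendSeq h (shiftMap^[k] x) (pastList x k)
  rw [appendSeq_pastList] at this
  have e := pastList_appendSeq (T.mapOf h (shiftMap^[k] x))
    (T.outWord (pastList x k) (T.pastState h (shiftMap^[k] x)))
  rw [← this, T.length_outWord, length_pastList] at e
  exact e.symm

theorem Transducer.exists_hasMemory : ∃ k, HasMemory (T.mapOf h) k := by
  obtain ⟨K, hK⟩ := T.exists_pastState_congr h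
  refine ⟨K + 1, hasMemory_of_zero (T.mapOf_shiftMap h) fun x y hxy => ?_⟩
  rw [T.mapOf_zero, T.mapOf_zero, hxy 0 (by omega),
    hK (shiftMap x) (shiftMap y) fun i hi => hxy (i + 1) (by omega)]

/-- Append the first `i` letters of a right-infinite word to a left-infinite sequence. -/
def appendInf (x w : ℕ → X) : ℕ → ℕ → X
  | 0 => x
  | i + 1 => pushSeq (appendInf x w i) (w i)

/-- The `ω`-class of a core state can be read off from the represented map and any past leading to
that state. -/
theorem Transducer.omegaMap_pastState (x w : ℕ → X) (i : ℕ) :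
    T.omegaMap (T.pastState h x) w i = T.mapOf h (appendInf x w (i + 1)) 0 := by
  have key : ∀ i, T.stateAt (T.pastState h x) w i = T.pastState h (appendInf x w i) := by
    intro i
    induction i with
    | zero => rfl
    | succ i ih => rw [Transducer.stateAt, ih, appendInf, Automaton.pastState_pushSeq]
  rw [Transducer.omegaMap, key]; rfl

theorem Transducer.mapOf_map {U : Transducer X S} {g : Q → S}
    (hg : ∀ x q, g (T.step x q) = U.step x (g q)) (ho : ∀ x q, T.out x q = U.out x (g q))
    (hU : U.toAutomaton.IsSynchronizing) : T.mapOf h = U.mapOf hU := by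
  funext x i
  rw [Transducer.mapOf, Transducer.mapOf, ← Automaton.pastState_map hg h hU, ho]

/-- A core transducer that represents the same map as a minimal transducer maps onto it. -/
theorem Transducer.exists_hom_of_mapOf_eq [Nonempty X] {U : Transducer X S}
    (hT : T.toAutomaton.IsSyncCore) (hU : U.toAutomaton.IsSynchronizing) (hm : U.IsMinimal)
    (e : T.mapOf hT.isSynchronizing = U.mapOf hU) :
    ∃ g : Q → S, (∀ x q, g (T.step x q) = U.step x (g q)) ∧ (∀ x q, T.out x q = U.out x (g q)) := by
  have hs := (Automaton.isSyncCore_iff hT.isSynchronizing).1 hT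
  -- Pasts with the same state in `T` have the same map on continuations, hence by minimality the
  -- same state in `U`; the chosen past is immaterial.
  have hg : ∀ x, U.pastState hU (Function.surjInv hs (T.pastState hT.isSynchronizing x)) = U.pastState hU x := by
    intro x
    apply hm
    funext w i
    rw [U.omegaMap_pastState, U.omegaMap_pastState, ← e, ← T.omegaMap_pastState,
      ← T.omegaMap_pastState, Function.surjInv_eq hs]
  refine ⟨fun q => U.pastState hU (Function.surjInv hs q), fun a q => ?_, fun a q => ?_⟩
  · obtain ⟨x, rfl⟩ := hs q
    beta_reduce
    rw [← Automaton.pastState_pushSeq, hg, hg, Automaton.pastState_pushSeq]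
  · obtain ⟨x, rfl⟩ := hs q
    beta_reduce
    rw [hg]
    have := congrFun (congrFun e (pushSeq x a)) 0
    exact this

end MapOf

/-! Infinite powers -/

section InfPow

variable {X : Type u} {Q : Type v}

/-- The letters that the successive factors of the infinite power read when the first one
reads `a`. -/
def Transducer.letters (T : Transducer X Q) (a : X) (σ : ℕ → Q) : ℕ → X
  | 0 => a
  | t + 1 => T.out (T.letters a σ t) (σ t)

/-- The underlying automaton of the product of infinitely many copies of `T`. -/
def Transducer.infPow (T : Transducer X Q) : Automaton X (ℕ → Q) where
  step a σ t := T.step (T.letters a σ t) (σ t)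

variable (T : Transducer X Q)

theorem Transducer.letters_succ (a : X) (σ : ℕ → Q) (t : ℕ) :
    T.letters a σ (t + 1) = T.letters (T.out a (σ 0)) (shiftMap σ) t := by
  induction t with
  | zero => rfl
  | succ t ih => rw [Transducer.letters, ih]; rfl

/-- Without its first factor the infinite power is again an infinite power, fed with the output of
that factor. -/
theorem Transducer.shiftMap_infPow_step (a : X) (σ : ℕ → Q) :
    shiftMap (T.infPow.step a σ) = T.infPow.step (T.out a (σ 0)) (shiftMap σ) := by
  funext t
  show T.step (T.letters a σ (t + 1)) (σ (t + 1)) = _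
  rw [T.letters_succ]; rfl

theorem Transducer.infPow_run_zero (l : List X) (σ : ℕ → Q) :
    T.infPow.run l σ 0 = T.run l (σ 0) := by
  induction l generalizing σ with
  | nil => rfl
  | cons a l ih => exact ih _

theorem Transducer.shiftMap_infPow_run (l : List X) (σ : ℕ → Q) :
    shiftMap (T.infPow.run l σ) = T.infPow.run (T.outWord l (σ 0)) (shiftMap σ) := by
  induction l generalizing σ with
  | nil => rfl
  | cons a l ih =>
    rw [Automaton.run, ih, T.shiftMap_infPow_step]; rfl

/-- The dual power in state `γ` reads `σ 0`, writes the state that `γ` leads to from there, and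
passes on the output of `γ`. This is one factor of the infinite power reading `γ`. -/
theorem Transducer.dualPow_omegaMap (m : ℕ) (γ : Word X m) (σ : ℕ → Q) :
    (T.dualPow m).omegaMap γ σ = T.infPow.run γ.toList σ := by
  funext i
  induction i generalizing γ σ with
  | zero => exact (T.infPow_run_zero _ _).symm
  | succ i ih =>
    have h := congrFun ((T.dualPow m).omegaMap_cons γ (σ 0) (shiftMap σ)) (i + 1)
    have e : (fun i => Nat.casesOn i (σ 0) (shiftMap σ) : ℕ → Q) = σ := pushSeq_shiftMap σ
    rw [e] at h
    rw [h]
    show (T.dualPow m).omegaMap _ (shiftMap σ) i = shiftMap (T.infPow.run γ.toList σ) i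
    rw [ih, T.shiftMap_infPow_run]; rfl

theorem Transducer.omegaEquiv_dualPow_iff {i j : ℕ} (γ : Word X i) (δ : Word X j) :
    OmegaEquiv (T.dualPow i) γ (T.dualPow j) δ ↔
      ∀ σ, T.infPow.run γ.toList σ = T.infPow.run δ.toList σ := by
  rw [OmegaEquiv, funext_iff]
  simp only [T.dualPow_omegaMap]

variable {T} (h : T.toAutomaton.IsSynchronizing)

theorem Transducer.pastState_iterate_pushSeq (x : ℕ → X) (a : X) (t : ℕ) :
    T.pastState h ((T.mapOf h)^[t] (pushSeq x a)) =
      T.infPow.step a (fun t => T.pastState h ((T.mapOf h)^[t] x)) t := by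
  have key : ∀ t, (T.mapOf h)^[t] (pushSeq x a) = pushSeq ((T.mapOf h)^[t] x)
      (T.letters a (fun t => T.pastState h ((T.mapOf h)^[t] x)) t) := by
    intro t
    induction t with
    | zero => rfl
    | succ t ih =>
      rw [Function.iterate_succ_apply', ih, T.mapOf_pushSeq, ← Function.iterate_succ_apply' (T.mapOf h)]
      rfl
  rw [key, Automaton.pastState_pushSeq]; rfl

/-- All words of some length reset all the powers of a core synchronizing transducer of finite
order at once. -/
theorem Transducer.exists_infPow_run_appendSeq [Nonempty X] (hc : T.toAutomaton.IsSyncCore) {N : ℕ}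
    (hN : 1 ≤ N) (hid : (T.mapOf hc.isSynchronizing)^[N] = id) :
    ∃ K, ∀ l : List X, K ≤ l.length → ∀ σ y t, T.infPow.run l σ t =
      T.pastState hc.isSynchronizing ((T.mapOf hc.isSynchronizing)^[t] (appendSeq y l)) := by
  obtain ⟨m, hm⟩ := T.exists_hasMemory hc.isSynchronizing
  obtain ⟨k, hk⟩ := T.exists_pastState_congr hc.isSynchronizing
  have hs := (Automaton.isSyncCore_iff hc.isSynchronizing).1 hc
  have hM := hm.iterate_of_periodic hN hid
  -- `k` letters determine the state of `T`, and `N * m` is a memory for every iterate of the map.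
  refine ⟨k + N * m, fun l hl σ y t => ?_⟩
  induction t generalizing l σ y with
  | zero =>
    rw [T.infPow_run_zero]
    obtain ⟨z, hz⟩ := hs (σ 0)
    rw [← hz, ← Automaton.pastState_appendSeq]
    exact hk _ _ ((agree_appendSeq z y l).mono (by omega))
  | succ t ih =>
    show shiftMap (T.infPow.run l σ) t = _
    obtain ⟨z, hz⟩ := hs (σ 0)
    -- Choose a past `z` leading to `σ 0`. The remaining factors read the output of `l` after the
    -- past `F z`, and the induction hypothesis applies to these; `z` may then be exchanged for `y`.
    rw [T.shiftMap_infPow_run, ih _ (by rwa [T.length_outWord])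
      _ (T.mapOf hc.isSynchronizing z), ← hz, ← T.mapOf_appendSeq,
      ← Function.iterate_succ_apply]
    exact hk _ _ (hM _ _ _ _ ((agree_appendSeq z y l).mono hl))

theorem Transducer.isSynchronizing_infPow [Nonempty X] (hc : T.toAutomaton.IsSyncCore) {N : ℕ}
    (hN : 1 ≤ N) (hid : (T.mapOf hc.isSynchronizing)^[N] = id) :
    T.infPow.IsSynchronizing := by
  obtain ⟨K, hK⟩ := T.exists_infPow_run_appendSeq hc hN hid
  have : Nonempty Q := Automaton.nonempty_of_isSynchronizing hc.isSynchronizing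
  refine ⟨K, Automaton.syncAt_of_run_eq fun l hl p q => ?_⟩
  funext t
  rw [hK l hl.ge p (fun _ => Classical.arbitrary X), hK l hl.ge]

/-- The states along the orbit of a past form a run of the infinite power, and synchronization makes
every run agree with it. -/
theorem Transducer.pastState_infPow (hi : T.infPow.IsSynchronizing) (x : ℕ → X) (t : ℕ) :
    T.infPow.pastState hi x t = T.pastState h ((T.mapOf h)^[t] x) := by
  obtain ⟨K, hK⟩ := T.infPow.exists_run_pastList hi
  have key : ∀ (l : List X) (x : ℕ → X),
      T.infPow.run l (fun t => T.pastState h ((T.mapOf h)^[t] x)) =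
      fun t => T.pastState h ((T.mapOf h)^[t] (appendSeq x l)) := by
    intro l
    induction l with
    | nil => intro x; rfl
    | cons a l ih =>
      intro x
      rw [appendSeq_cons, ← ih, Automaton.run]
      congr 1
      funext t
      exact (T.pastState_iterate_pushSeq h x a t).symm
  rw [← hK K le_rfl x (fun t => T.pastState h ((T.mapOf h)^[t] (shiftMap^[K] x))), key,
    appendSeq_pastList]

theorem Transducer.shiftMap_pastState_infPow (hi : T.infPow.IsSynchronizing) (x : ℕ → X) :
    shiftMap (T.infPow.pastState hi x) = T.infPow.pastState hi (T.mapOf h x) := by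
  funext t
  show T.infPow.pastState hi x (t + 1) = _
  rw [T.pastState_infPow h, T.pastState_infPow h, Function.iterate_succ_apply]

end InfPow

/-! Products, powers and finite order -/

section Powers

variable {X : Type u} {Q : Type v} {S : Type w}

theorem Transducer.run_prod (T : Transducer X Q) (U : Transducer X S) (l : List X) (q : Q × S) :
    (T.prod U).run l q = (T.run l q.1, U.run (T.outWord l q.1) q.2) := by
  induction l generalizing q with
  | nil => rfl
  | cons a l ih => exact ih _

/-- The older `K` letters reset `T`, so on the last `L` letters it writes what the represented map
writes, and this resets `U`. -/
theorem Transducer.exists_run_prod [Nonempty X] {T : Transducer X Q} {U : Transducer X S}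
    (hT : T.toAutomaton.IsSynchronizing) (hU : U.toAutomaton.IsSynchronizing) :
    ∃ K, ∀ x q, (T.prod U).run (pastList x K) q =
      (T.pastState hT x, U.pastState hU (T.mapOf hT x)) := by
  obtain ⟨K, hK⟩ := T.exists_run_pastList hT
  obtain ⟨L, hL⟩ := U.exists_run_pastList hU
  refine ⟨K + L, fun x q => ?_⟩
  rw [pastList_add, Automaton.run_append, Transducer.run_prod, Transducer.run_prod]
  dsimp only
  rw [hK K le_rfl, ← Automaton.pastState_appendSeq, appendSeq_pastList, T.outWord_pastList hT,
    hL L le_rfl]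

theorem Transducer.isSynchronizing_prod [Nonempty X] {T : Transducer X Q} {U : Transducer X S}
    (hT : T.toAutomaton.IsSynchronizing) (hU : U.toAutomaton.IsSynchronizing) :
    (T.prod U).toAutomaton.IsSynchronizing := by
  obtain ⟨K, hK⟩ := Transducer.exists_run_prod hT hU
  exact ⟨K, Automaton.syncAt_of_run_pastList hK⟩

theorem Transducer.mapOf_prod [Nonempty X] {T : Transducer X Q} {U : Transducer X S}
    (hT : T.toAutomaton.IsSynchronizing) (hU : U.toAutomaton.IsSynchronizing)
    (h : (T.prod U).toAutomaton.IsSynchronizing) (x : ℕ → X) :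
    (T.prod U).mapOf h x = U.mapOf hU (T.mapOf hT x) := by
  obtain ⟨K, hK⟩ := Transducer.exists_run_prod hT hU
  have hp := Automaton.pastState_eq_of_run_pastList h hK
  funext i
  simp only [Transducer.mapOf, hp]
  show U.out (T.out _ _) _ = _
  dsimp only
  rw [map_iterate_shiftMap (T.mapOf_shiftMap hT)]

theorem Transducer.isSynchronizing_pow [Nonempty X] {T : Transducer X Q}
    (hT : T.toAutomaton.IsSynchronizing) (m : ℕ) : (T.pow m).toAutomaton.IsSynchronizing := by
  induction m with
  | zero => exact ⟨0, fun _ => PUnit.unit, fun _ _ => rfl⟩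
  | succ m ih => exact Transducer.isSynchronizing_prod ih hT

theorem Transducer.mapOf_pow [Nonempty X] {T : Transducer X Q}
    (hT : T.toAutomaton.IsSynchronizing) (m : ℕ) (h : (T.pow m).toAutomaton.IsSynchronizing) :
    (T.pow m).mapOf h = (T.mapOf hT)^[m] := by
  induction m with
  | zero => rfl
  | succ m ih =>
    funext x
    rw [Function.iterate_succ_apply', ← ih (Transducer.isSynchronizing_pow hT m)]
    exact Transducer.mapOf_prod _ _ _ x

theorem Transducer.core_omegaEquiv_identity_iff [Nonempty X] {T : Transducer X Q}
    (h : T.toAutomaton.IsSynchronizing) :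
    (∀ q, T.toAutomaton.IsCoreState q →
      OmegaEquiv T q (Transducer.identity.{u, 0} X) PUnit.unit) ↔ T.mapOf h = id := by
  constructor
  · intro hc
    funext x i
    have := hc _ ((Automaton.isCoreState_iff h _).2 ⟨shiftMap^[i + 1] x, rfl⟩)
    exact congrFun (congrFun this (fun _ => x i)) 0
  · intro hid q hq
    obtain ⟨x, rfl⟩ := (Automaton.isCoreState_iff h _).1 hq
    funext w i
    rw [T.omegaMap_pastState, hid]
    rfl

/-- Powers of transducers represent iterates, and a synchronizing transducer represents the identity
exactly when its core copies the input. -/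
theorem Transducer.finiteOrder_iff [Nonempty X] {T : Transducer X Q}
    (h : T.toAutomaton.IsSynchronizing) :
    T.FiniteOrder ↔ ∃ m, 1 ≤ m ∧ (T.mapOf h)^[m] = id := by
  refine exists_congr fun m => and_congr_right fun _ => ?_
  rw [← Transducer.mapOf_pow h m (Transducer.isSynchronizing_pow h m),
    ← Transducer.core_omegaEquiv_identity_iff]
  exact and_iff_right (Transducer.isSynchronizing_pow h m)

end Powers

/-! The zero of the semigroup of powers of the dual -/

section ZeroLevel

variable {X : Type u} {Q : Type v} {S : Type w}

theorem Transducer.minRep_omegaMap (T : Transducer X Q) (q : Q) :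
    T.minRep.omegaMap (Quotient.mk T.omegaSetoid q) = T.omegaMap q := by
  funext x i
  have key : ∀ i, T.minRep.stateAt (Quotient.mk T.omegaSetoid q) x i =
      Quotient.mk T.omegaSetoid (T.stateAt q x i) := by
    intro i
    induction i with
    | zero => rfl
    | succ i ih => rw [Transducer.stateAt, ih]; rfl
  rw [Transducer.omegaMap, key]; rfl

/-- Removes the quotients: only `ω`-equivalent partners in both directions are needed. -/
theorem omegaEq_minRep_iff {T : Transducer X Q} {U : Transducer X S} :
    OmegaEq T.minRep U.minRep ↔
      (∀ q, ∃ s, OmegaEquiv T q U s) ∧ ∀ s, ∃ q, OmegaEquiv T q U s := by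
  constructor
  · rintro ⟨f, hf⟩
    constructor
    · intro q
      obtain ⟨s, hs⟩ := Quotient.exists_rep (f (Quotient.mk _ q))
      refine ⟨s, ?_⟩
      have := hf (Quotient.mk _ q)
      rw [← hs, OmegaEquiv, T.minRep_omegaMap, U.minRep_omegaMap] at this
      exact this
    · intro s
      obtain ⟨q, hq⟩ := Quotient.exists_rep (f.symm (Quotient.mk _ s))
      refine ⟨q, ?_⟩
      have := hf (Quotient.mk _ q)
      rw [hq, Equiv.apply_symm_apply, ← hq, OmegaEquiv, T.minRep_omegaMap,
        U.minRep_omegaMap] at this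
      exact this
  · rintro ⟨h1, h2⟩
    choose f hf using h1
    have key : ∀ p q, OmegaEquiv T p T q ↔ OmegaEquiv U (f p) U (f q) := fun p q =>
      ⟨fun h => ((hf p).symm.trans h).trans (hf q), fun h => ((hf p).trans h).trans (hf q).symm⟩
    refine ⟨Equiv.ofBijective (Quotient.map' (s₁ := T.omegaSetoid) (s₂ := U.omegaSetoid) f
      fun p q h => (key p q).1 h) ⟨?_, ?_⟩, ?_⟩
    · rintro ⟨p⟩ ⟨q⟩ h
      exact Quotient.sound ((key p q).2 (Quotient.exact h))
    · rintro ⟨s⟩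
      obtain ⟨q, hq⟩ := h2 s
      exact ⟨Quotient.mk _ q, Quotient.sound ((hf q).symm.trans hq)⟩
    · rintro ⟨q⟩
      exact (T.minRep_omegaMap q).trans ((hf q).trans (U.minRep_omegaMap (f q)).symm)

/-- A list of the right length as a word. -/
def Word.ofList {k : ℕ} (l : List X) (h : l.length = k) : Word X k := ⟨l, h⟩

@[simp] theorem Word.toList_ofList {k : ℕ} (l : List X) (h : l.length = k) :
    (Word.ofList l h).toList = l := rfl

theorem Word.toList_push {m : ℕ} (γ : Word X m) (x : X) :
    (Word.push γ x).toList = (γ.toList ++ [x]).tail := rfl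

variable {T : Transducer X Q}

/-- A longer word acts like its last `k` letters, and a word of length `k` acts like any extension
of it to the left. -/
theorem Transducer.isZeroLevel_of_syncAt [Nonempty X] {k : ℕ} (hk : 1 ≤ k)
    (h : T.infPow.SyncAt k) : T.IsZeroLevel k := by
  refine ⟨hk, fun j hj => omegaEq_minRep_iff.2 ⟨fun γ => ?_, fun γ => ?_⟩⟩
  · refine ⟨Word.ofList (γ.toList.drop (j - k)) (by rw [List.length_drop, γ.toList_length]; omega), ?_⟩
    rw [T.omegaEquiv_dualPow_iff]
    intro σ
    conv_lhs => rw [← List.take_append_drop (j - k) γ.toList, Automaton.run_append]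
    exact h.run_eq _ (by rw [List.length_drop, γ.toList_length]; omega) _ _
  · refine ⟨Word.ofList (List.replicate (j - k) (Classical.arbitrary X) ++ γ.toList) (by
      rw [List.length_append, List.length_replicate, γ.toList_length]; omega), ?_⟩
    rw [T.omegaEquiv_dualPow_iff]
    intro σ
    rw [Word.toList_ofList, Automaton.run_append]
    exact h.run_eq _ γ.toList_length.ge _ _

/-- At a zero level, a word of length `k` acts like some word longer than a synchronizing level,
hence as a constant. -/
theorem Transducer.run_eq_of_isZeroLevel (h : T.infPow.IsSynchronizing) {k : ℕ}
    (hk : T.IsZeroLevel k) (l : List X) (hl : l.length = k) (σ τ : ℕ → Q) :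
    T.infPow.run l σ = T.infPow.run l τ := by
  obtain ⟨K, hK⟩ := h
  obtain ⟨δ, hδ⟩ := (omegaEq_minRep_iff.1 (hk.2 (k + K) (by omega))).2 (Word.ofList l hl)
  rw [T.omegaEquiv_dualPow_iff] at hδ
  have hσ := hδ σ
  have hτ := hδ τ
  rw [Word.toList_ofList] at hσ hτ
  rw [← hσ, ← hτ]
  exact hK.run_eq _ (by rw [δ.toList_length]; omega) _ _

theorem Transducer.isLeast_zeroLevel [Nonempty X] (h : T.infPow.IsSynchronizing) :
    IsLeast {k | T.IsZeroLevel k} T.zeroLevel := by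
  obtain ⟨K, hK⟩ := h
  have : Nonempty (ℕ → Q) := Automaton.nonempty_of_isSynchronizing ⟨K, hK⟩
  -- `K` may be `0`, whereas a zero level is positive.
  have hne : {k | T.IsZeroLevel k}.Nonempty := ⟨K + 1, T.isZeroLevel_of_syncAt (by omega)
    (Automaton.syncAt_of_run_eq fun l hl p q => hK.run_eq l (by omega) p q)⟩
  exact ⟨Nat.sInf_mem hne, fun k hk => Nat.sInf_le hk⟩

/-- The states of the zero, viewed as states of the infinite power: `[γ]` goes to the state
reached from `σ` by reading `γ`. -/
noncomputable def Transducer.dualEmbedding (T : Transducer X Q) (σ : ℕ → Q) (c : T.DualState) :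
    ℕ → Q :=
  Quotient.lift (s := (T.dualPow T.zeroLevel).omegaSetoid) (fun γ => T.infPow.run γ.toList σ)
    (fun γ δ hγ => (T.omegaEquiv_dualPow_iff γ δ).1 hγ σ) c

theorem Transducer.exists_cls (c : T.DualState) : ∃ γ, T.cls γ = c := Quotient.exists_rep c

variable [Nonempty X]

theorem Transducer.run_eq_of_zeroLevel (h : T.infPow.IsSynchronizing)
    (l : List X) (hl : l.length = T.zeroLevel) (τ τ' : ℕ → Q) :
    T.infPow.run l τ = T.infPow.run l τ' :=
  T.run_eq_of_isZeroLevel h (T.isLeast_zeroLevel h).1 l hl τ τ'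

theorem Transducer.dualEmbedding_cls (h : T.infPow.IsSynchronizing) (σ : ℕ → Q)
    (γ : Word X T.zeroLevel) (τ : ℕ → Q) :
    T.dualEmbedding σ (T.cls γ) = T.infPow.run γ.toList τ :=
  T.run_eq_of_zeroLevel h _ γ.toList_length _ _

/-- Words of zero-level length act as constants, so their values at the single point `σ` determine
their classes. -/
theorem Transducer.dualEmbedding_injective (h : T.infPow.IsSynchronizing) (σ : ℕ → Q) :
    Function.Injective (T.dualEmbedding σ) := by
  intro c d hcd
  obtain ⟨γ, rfl⟩ := T.exists_cls c
  obtain ⟨δ, rfl⟩ := T.exists_cls d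
  refine Quotient.sound ((T.omegaEquiv_dualPow_iff γ δ).2 fun τ => ?_)
  rw [← T.dualEmbedding_cls h σ, hcd, T.dualEmbedding_cls h σ]

/-- After `x` is appended, the last `zeroLevel` letters already reset the infinite power, so the
first letter can be dropped. With injectivity this makes the transition of the dual automaton well
defined. -/
theorem Transducer.dualEmbedding_push (h : T.infPow.IsSynchronizing) (σ : ℕ → Q)
    (γ : Word X T.zeroLevel) (x : X) :
    T.dualEmbedding σ (T.cls (Word.push γ x)) =
      T.infPow.step x (T.dualEmbedding σ (T.cls γ)) := by
  rw [T.dualEmbedding_cls h σ γ σ, T.dualEmbedding_cls h σ _ σ, Word.toList_push]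
  have hl := (T.isLeast_zeroLevel h).1.1
  rw [← γ.toList_length] at hl
  have hlen : (γ.toList ++ [x]).tail.length = T.zeroLevel := by simp
  have e : T.infPow.run (γ.toList ++ [x]) σ = T.infPow.step x (T.infPow.run γ.toList σ) := by
    rw [Automaton.run_append]; rfl
  rw [← e]
  cases hγ : γ.toList ++ [x] with
  | nil => simp at hγ
  | cons a l =>
    rw [hγ] at hlen
    exact T.run_eq_of_zeroLevel h l hlen _ _

theorem Transducer.dualAutomaton_step_cls (h : T.infPow.IsSynchronizing)
    (γ : Word X T.zeroLevel) (x : X) :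
    T.dualAutomaton.step x (T.cls γ) = T.cls (Word.push γ x) := by
  obtain ⟨σ⟩ : Nonempty (ℕ → Q) := Automaton.nonempty_of_isSynchronizing h
  apply T.dualEmbedding_injective h σ
  show T.dualEmbedding σ (T.cls (Word.push (Quotient.out (T.cls γ)) x)) = _
  rw [T.dualEmbedding_push h, T.dualEmbedding_push h]
  congr 2
  exact Quotient.out_eq (T.cls γ)

theorem Transducer.dualEmbedding_step (h : T.infPow.IsSynchronizing) (σ : ℕ → Q)
    (x : X) (c : T.DualState) :
    T.dualEmbedding σ (T.dualAutomaton.step x c) = T.infPow.step x (T.dualEmbedding σ c) := by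
  obtain ⟨γ, rfl⟩ := T.exists_cls c
  rw [T.dualAutomaton_step_cls h, T.dualEmbedding_push h]

theorem Transducer.isSyncCore_dualAutomaton (h : T.infPow.IsSynchronizing) :
    T.dualAutomaton.IsSyncCore := by
  obtain ⟨σ⟩ : Nonempty (ℕ → Q) := Automaton.nonempty_of_isSynchronizing h
  have x₀ : ℕ → X := fun _ => Classical.arbitrary X
  have : Nonempty T.DualState :=
    ⟨T.cls (Word.ofList (pastList x₀ T.zeroLevel) (length_pastList _ _))⟩
  have hs : T.dualAutomaton.IsSynchronizing := by
    refine ⟨T.zeroLevel, Automaton.syncAt_of_run_eq fun l hl c d => ?_⟩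
    apply T.dualEmbedding_injective h σ
    rw [Automaton.run_map (T.dualEmbedding_step h σ), Automaton.run_map (T.dualEmbedding_step h σ)]
    exact T.run_eq_of_zeroLevel h l hl _ _
  rw [Automaton.isSyncCore_iff hs]
  intro c
  obtain ⟨γ, rfl⟩ := T.exists_cls c
  refine ⟨appendSeq x₀ γ.toList, ?_⟩
  apply T.dualEmbedding_injective h σ
  rw [Automaton.pastState_map (T.dualEmbedding_step h σ) hs h, T.dualEmbedding_cls h,
    Automaton.pastState_appendSeq]

end ZeroLevel

/-! The action on the zero -/

section DualAction

variable {X : Type u} {Q : Type v} {S : Type w}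

theorem DigraphAut.ext_of_edge {A : Automaton X Q} {φ ψ : DigraphAut A}
    (hv : ∀ q, φ.vertex q = ψ.vertex q) (he : ∀ q x, φ.edge (q, x) = ψ.edge (q, x)) : φ = ψ :=
  DigraphAut.ext (Equiv.ext hv) (Equiv.ext fun p => he p.1 p.2)

/-- A digraph automorphism from a vertex map and a map of labels. -/
theorem DigraphAut.exists_of_maps [Finite X] [Finite Q] (A : Automaton X Q) (f : Q → Q)
    (o : X → Q → X) (hf : Function.Injective f) (ho : ∀ q, Function.Injective (fun x => o x q))
    (hs : ∀ q x, A.step (o x q) (f q) = f (A.step x q)) :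
    ∃ φ : DigraphAut A, (∀ q, φ.vertex q = f q) ∧ ∀ q x, φ.edge (q, x) = (f q, o x q) := by
  have he : Function.Injective (fun p : Q × X => (f p.1, o p.2 p.1)) := by
    rintro ⟨p, x⟩ ⟨q, y⟩ h
    rw [Prod.mk.injEq] at h
    obtain rfl : p = q := hf h.1
    have hxy : x = y := ho p h.2
    rw [hxy]
  exact ⟨⟨Equiv.ofBijective f (Finite.injective_iff_bijective.1 hf),
    Equiv.ofBijective _ (Finite.injective_iff_bijective.1 he), fun _ _ => rfl, hs⟩,
    fun _ => rfl, fun _ _ => rfl⟩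

theorem DigraphAut.edge_eq {A : Automaton X Q} (φ : DigraphAut A) (q : Q) (x : X) :
    φ.edge (q, x) = (φ.vertex q, φ.transducer.out x q) :=
  Prod.ext (φ.source_edge q x) rfl

theorem DigraphAut.step_out {A : Automaton X Q} (φ : DigraphAut A) (q : Q) (x : X) :
    A.step (φ.transducer.out x q) (φ.vertex q) = φ.vertex (A.step x q) := by
  rw [← φ.target_edge, ← φ.source_edge q x]; rfl

instance [Finite X] (k : ℕ) : Finite (Word X k) := by
  cases nonempty_fintype X
  exact inferInstanceAs (Finite (List.Vector X k))

instance [Finite X] (T : Transducer X Q) : Finite T.DualState := Quotient.finite _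

/-- The data of the action on the zero: the embedding of its states into the infinite power
carries the vertex map of `φ` to the shift. -/
structure Transducer.IsDualEmbedding (T : Transducer X Q) (φ : DigraphAut T.dualAutomaton)
    (emb : T.DualState → ℕ → Q) : Prop where
  injective : Function.Injective emb
  step : ∀ x c, emb (T.dualAutomaton.step x c) = T.infPow.step x (emb c)
  vertex : ∀ c, emb (φ.vertex c) = shiftMap (emb c)
  out : ∀ x c, φ.transducer.out x c = T.out x (emb c 0)

/-- The embedded vertices are the state sequences along orbits of the represented map. This set is
invariant under the shift, which gives the vertex map; the label of an image edge is what coordinate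
`0` writes. -/
theorem Transducer.exists_dualAction [Nonempty X] [Finite X] {T : Transducer X Q} (hc : T.toAutomaton.IsSyncCore)
    (hinv : T.IsInvertible) (hfin : T.FiniteOrder) :
    ∃ φ : DigraphAut T.dualAutomaton, T.IsDualAction φ ∧ ∃ emb, T.IsDualEmbedding φ emb := by
  obtain ⟨N, hN, hid⟩ := (Transducer.finiteOrder_iff hc.isSynchronizing).1 hfin
  have h := T.isSynchronizing_infPow hc hN hid
  obtain ⟨σ⟩ : Nonempty (ℕ → Q) := Automaton.nonempty_of_isSynchronizing h
  have hB := T.isSyncCore_dualAutomaton h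
  have hs := (Automaton.isSyncCore_iff hB.isSynchronizing).1 hB
  have hemb := T.dualEmbedding_injective h σ
  have hpast := Automaton.pastState_map (T.dualEmbedding_step h σ) hB.isSynchronizing h
  have hv : ∀ c, ∃ d, T.dualEmbedding σ d = shiftMap (T.dualEmbedding σ c) := by
    intro c
    obtain ⟨x, rfl⟩ := hs c
    refine ⟨T.dualAutomaton.pastState hB.isSynchronizing (T.mapOf hc.isSynchronizing x), ?_⟩
    rw [hpast, hpast, T.shiftMap_pastState_infPow hc.isSynchronizing]
  choose f hf using hv
  have hper : ∀ c t, T.dualEmbedding σ c (t + N) = T.dualEmbedding σ c t := by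
    intro c t
    obtain ⟨x, rfl⟩ := hs c
    rw [hpast, T.pastState_infPow hc.isSynchronizing, T.pastState_infPow hc.isSynchronizing,
      Function.iterate_add_apply, hid, id]
  -- The shift loses coordinate `0`, but periodicity recovers coordinate `t` from coordinate `t +
  -- N`.
  have hfi : Function.Injective f := by
    intro c d hcd
    apply hemb
    funext t
    have := congrFun ((hf c).symm.trans ((congrArg _ hcd).trans (hf d))) (t + N - 1)
    simp only [shiftMap, show t + N - 1 + 1 = t + N by omega, hper] at this
    exact this
  obtain ⟨φ, hφv, hφe⟩ := DigraphAut.exists_of_maps T.dualAutomaton f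
    (fun x c => T.out x (T.dualEmbedding σ c 0)) hfi (fun c => (hinv _).1) (by
      intro c x
      apply hemb
      rw [T.dualEmbedding_step h, hf, hf, T.dualEmbedding_step h, T.shiftMap_infPow_step])
  -- The base point is immaterial, so it may start with `p`; deleting that factor leaves a run on
  -- the output of `γ` from `p`.
  have hfc : ∀ γ p, f (T.cls γ) = T.cls ((T.blocks T.zeroLevel).out γ p) := by
    intro γ p
    apply hemb
    have := T.shiftMap_infPow_run γ.toList (pushSeq σ p)
    rw [hf, T.dualEmbedding_cls h σ γ (pushSeq σ p), this]
    exact (T.dualEmbedding_cls h σ ((T.blocks T.zeroLevel).out γ p) (shiftMap (pushSeq σ p))).symm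
  refine ⟨φ, fun γ p => ⟨by rw [hφv, hfc γ p], fun x => ?_⟩, T.dualEmbedding σ, hemb,
    T.dualEmbedding_step h σ, fun c => by rw [hφv, hf], fun x c => ?_⟩
  · rw [hφe, hfc γ p, T.dualEmbedding_cls h σ γ (pushSeq σ p), T.infPow_run_zero]
    rfl
  · exact congrArg Prod.snd (hφe c x)

/-! Supports -/

theorem inducedFrom_of_hom {T : Transducer X Q} (hT : T.toAutomaton.IsSynchronizing)
    {A : Automaton X S} (hA : A.IsSyncCore) {ψ : DigraphAut A} {g : S → Q}
    (hg : ∀ x a, g (A.step x a) = T.step x (g a))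
    (ho : ∀ x a, ψ.transducer.out x a = T.out x (g a)) : InducedFrom T ψ :=
  ⟨hA, sameMap_iff.2 ⟨hT, hA.isSynchronizing,
    (Transducer.mapOf_map (T := ψ.transducer) hA.isSynchronizing hg ho hT).symm⟩⟩

theorem InducedFrom.exists_hom [Nonempty X] {T : Transducer X Q} (hmin : T.IsMinimal)
    {A : Automaton X S} {ψ : DigraphAut A} (h : InducedFrom T ψ) :
    ∃ g : S → Q, (∀ x a, g (A.step x a) = T.step x (g a)) ∧
      ∀ x a, ψ.transducer.out x a = T.out x (g a) := by
  obtain ⟨hA, hsame⟩ := h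
  obtain ⟨hT, hψ, e⟩ := sameMap_iff.1 hsame
  exact Transducer.exists_hom_of_mapOf_eq (T := ψ.transducer) hA hT hmin e.symm

/-- A homomorphism to a synchronizing automaton is unique on the core. -/
theorem Automaton.hom_unique [Nonempty X] {A : Automaton X S} (hA : A.IsSyncCore) {B : Automaton X Q}
    (hB : B.IsSynchronizing) {g g' : S → Q} (hg : ∀ x a, g (A.step x a) = B.step x (g a))
    (hg' : ∀ x a, g' (A.step x a) = B.step x (g' a)) : g = g' := by
  funext a
  obtain ⟨x, rfl⟩ := (Automaton.isSyncCore_iff hA.isSynchronizing).1 hA a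
  rw [Automaton.pastState_map hg hA.isSynchronizing hB,
    Automaton.pastState_map hg' hA.isSynchronizing hB]

/-- A homomorphism of automata that carries the digraph automorphism `ψ` to `φ`. -/
structure DigraphAut.IsHom {A : Automaton X S} {B : Automaton X Q} (ψ : DigraphAut A)
    (φ : DigraphAut B) (g : S → Q) : Prop where
  step : ∀ x a, g (A.step x a) = B.step x (g a)
  vertex : ∀ a, g (ψ.vertex a) = φ.vertex (g a)
  edge : ∀ a x, φ.edge (g a, x) = (g (ψ.edge (a, x)).1, (ψ.edge (a, x)).2)

theorem DigraphAut.IsHom.out {A : Automaton X S} {B : Automaton X Q} {ψ : DigraphAut A}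
    {φ : DigraphAut B} {g : S → Q} (h : ψ.IsHom φ g) (x : X) (a : S) :
    ψ.transducer.out x a = φ.transducer.out x (g a) :=
  (congrArg Prod.snd (h.edge a x)).symm

theorem DigraphAut.IsHom.of_out {A : Automaton X S} {B : Automaton X Q} {ψ : DigraphAut A}
    {φ : DigraphAut B} {g : S → Q} (hs : ∀ x a, g (A.step x a) = B.step x (g a))
    (hv : ∀ a, g (ψ.vertex a) = φ.vertex (g a))
    (ho : ∀ x a, ψ.transducer.out x a = φ.transducer.out x (g a)) : ψ.IsHom φ g :=
  ⟨hs, hv, fun a x => by rw [φ.edge_eq, ψ.edge_eq, hv, ho]⟩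

theorem DigraphAut.IsHom.iso {A : Automaton X S} {B : Automaton X Q} {ψ : DigraphAut A}
    {φ : DigraphAut B} {g : S → Q} (h : ψ.IsHom φ g) (hg : Function.Bijective g) : ψ.Iso φ :=
  ⟨Equiv.ofBijective g hg, h.step, h.vertex, h.edge⟩

/-- Every support maps onto the automaton of the zero. -/
theorem InducedFrom.exists_isHom [Nonempty X] {T : Transducer X Q} (hc : T.toAutomaton.IsSyncCore)
    (hmin : T.IsMinimal) (hfin : T.FiniteOrder)
    {φ : DigraphAut T.dualAutomaton} {emb : T.DualState → ℕ → Q} (hφ : T.IsDualEmbedding φ emb)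
    {A : Automaton X S} {ψ : DigraphAut A} (hψ : InducedFrom T ψ) :
    ∃ g : S → T.DualState, Function.Surjective g ∧ ψ.IsHom φ g := by
  obtain ⟨N, hN, hid⟩ := (Transducer.finiteOrder_iff hc.isSynchronizing).1 hfin
  have hi := T.isSynchronizing_infPow hc hN hid
  have hB := T.isSyncCore_dualAutomaton hi
  have hA := hψ.1
  obtain ⟨u, hu, huo⟩ := hψ.exists_hom hmin
  -- The letter read by factor `t` is the label of the image under `ψ^t` of the edge `(a, x)`.
  have hstep : ∀ x a, (fun t => u (ψ.vertex^[t] (A.step x a))) =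
      T.infPow.step x (fun t => u (ψ.vertex^[t] a)) := by
    intro x a
    have key : ∀ t, ψ.vertex^[t] (A.step x a) =
        A.step (T.letters x (fun t => u (ψ.vertex^[t] a)) t) (ψ.vertex^[t] a) := by
      intro t
      induction t with
      | zero => rfl
      | succ t ih =>
        rw [Function.iterate_succ_apply', ih, ← ψ.step_out, huo, Function.iterate_succ_apply']
        rfl
    funext t
    rw [key, hu]; rfl
  have hpA := Automaton.pastState_map (g := fun a t => u (ψ.vertex^[t] a)) hstep
    hA.isSynchronizing hi
  have hpB := Automaton.pastState_map hφ.step hB.isSynchronizing hi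
  have hsA := (Automaton.isSyncCore_iff hA.isSynchronizing).1 hA
  have hsB := (Automaton.isSyncCore_iff hB.isSynchronizing).1 hB
  -- Both homomorphisms to the infinite power start from core automata, so the same past leads to
  -- the same image under each.
  have hg : ∀ a, ∃ c, emb c = fun t => u (ψ.vertex^[t] a) := by
    intro a
    obtain ⟨x, rfl⟩ := hsA a
    exact ⟨_, (hpB x).trans (hpA x).symm⟩
  choose g hg using hg
  refine ⟨g, fun c => ?_, DigraphAut.IsHom.of_out (fun x a => ?_) (fun a => ?_) fun x a => ?_⟩
  · obtain ⟨x, rfl⟩ := hsB c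
    exact ⟨_, hφ.injective ((hg _).trans ((hpA x).trans (hpB x).symm))⟩
  · apply hφ.injective
    rw [hg, hφ.step, hg, hstep]
  · apply hφ.injective
    rw [hg, hφ.vertex, hg]
    rfl
  · rw [huo, hφ.out, hg]; rfl

/-- Coordinate `0` of the embedding is a homomorphism to `T` that preserves outputs. -/
theorem Transducer.IsDualEmbedding.inducedFrom {T : Transducer X Q}
    (hT : T.toAutomaton.IsSynchronizing) (hB : T.dualAutomaton.IsSyncCore)
    {φ : DigraphAut T.dualAutomaton} {emb : T.DualState → ℕ → Q} (hφ : T.IsDualEmbedding φ emb) :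
    InducedFrom T φ :=
  inducedFrom_of_hom hT hB (g := fun c => emb c 0) (fun x c => congrFun (hφ.step x c) 0) hφ.out

theorem Automaton.isFolding_ker {A : Automaton X S} {B : Automaton X Q} {g : S → Q}
    (hg : ∀ x a, g (A.step x a) = B.step x (g a)) : A.IsFolding (Setoid.ker g) := by
  intro x p q h
  rw [Setoid.ker_def] at h ⊢
  rw [hg, hg, h]

theorem Automaton.fold_ker_iso {A : Automaton X S} {B : Automaton X Q} {g : S → Q}
    (hg : ∀ x a, g (A.step x a) = B.step x (g a)) (hs : Function.Surjective g) :
    (A.fold (Setoid.ker g) (Automaton.isFolding_ker hg)).Iso B := by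
  refine ⟨Setoid.quotientKerEquivOfSurjective g hs, fun x q => ?_⟩
  obtain ⟨a, rfl⟩ := Quotient.exists_rep q
  exact hg x a

theorem DigraphAut.exists_isHom_of_equiv {A : Automaton X S} {B : Automaton X Q} (e : S ≃ Q)
    (he : ∀ x a, e (A.step x a) = B.step x (e a)) (φ : DigraphAut B) :
    ∃ ψ : DigraphAut A, ψ.IsHom φ e := by
  refine ⟨⟨(e.trans φ.vertex).trans e.symm,
    ((e.prodCongr (Equiv.refl X)).trans φ.edge).trans (e.prodCongr (Equiv.refl X)).symm,
    fun a x => ?_, fun a x => ?_⟩, he, fun a => ?_, fun a x => ?_⟩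
  · show e.symm (φ.edge (e a, x)).1 = _
    rw [φ.source_edge]; rfl
  · apply e.injective
    rw [he]
    show B.step (φ.edge (e a, x)).2 (e (e.symm (φ.edge (e a, x)).1)) =
      e (e.symm (φ.vertex (e (A.step x a))))
    rw [Equiv.apply_symm_apply, Equiv.apply_symm_apply, φ.target_edge, he]
  · show e (e.symm (φ.vertex (e a))) = _
    rw [Equiv.apply_symm_apply]
  · show _ = (e (e.symm (φ.edge (e a, x)).1), (φ.edge (e a, x)).2)
    rw [Equiv.apply_symm_apply]

theorem InducedFrom.of_isHom [Nonempty X] {P : Type*} {T : Transducer X P} {A : Automaton X S}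
    {B : Automaton X Q} {ψ : DigraphAut A} {φ : DigraphAut B} {e : S ≃ Q} (h : InducedFrom T φ)
    (he : ψ.IsHom φ e) : InducedFrom T ψ := by
  obtain ⟨hB, hsame⟩ := h
  obtain ⟨hT, hφ, hm⟩ := sameMap_iff.1 hsame
  have hA : A.IsSyncCore := by
    refine Automaton.isSyncCore_of_surjective (g := e.symm) (fun x q => ?_) e.symm.surjective hB
    rw [Equiv.symm_apply_eq, he.step, Equiv.apply_symm_apply]
  exact ⟨hA, sameMap_iff.2 ⟨hT, hA.isSynchronizing, hm.trans
    (Transducer.mapOf_map (T := ψ.transducer) (U := φ.transducer) hA.isSynchronizing he.step he.out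
      hφ).symm⟩⟩

theorem Supports.of_iso [Nonempty X] {P : Type*} {T : Transducer X P} {A : Automaton X S}
    {B : Automaton X Q} (h : Supports B T) (hAB : A.Iso B) : Supports A T := by
  obtain ⟨φ, hφ⟩ := h
  obtain ⟨e, he⟩ := hAB
  obtain ⟨ψ, hψ⟩ := DigraphAut.exists_isHom_of_equiv e he φ
  exact ⟨ψ, hφ.of_isHom hψ⟩

/-- The automaton of the zero and its automorphism are the minimal support. -/
theorem dualAutomaton_minimal_support {n : ℕ} (hn : 1 ≤ n) {H : Transducer (Fin n) Q} (hH : IsHn H)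
    (hfin : H.FiniteOrder) :
    IsLeast {k | H.IsZeroLevel k} H.zeroLevel ∧
      (∀ (γ : Word (Fin n) H.zeroLevel) (x : Fin n),
        H.dualAutomaton.step x (H.cls γ) = H.cls (Word.push γ x)) ∧
      (∃ φ : DigraphAut H.dualAutomaton, H.IsDualAction φ ∧
        ∀ ψ : DigraphAut H.dualAutomaton, InducedFrom H ψ ↔ ψ = φ) ∧
      IsMinimalSupport H.dualAutomaton H ∧
      (∀ (S : Type w) [Finite S] (A : Automaton (Fin n) S),
        IsMinimalSupport A H → A.Iso H.dualAutomaton) ∧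
      (∀ (S : Type w) [Finite S] (A : Automaton (Fin n) S),
        Supports A H → A.FoldsOnto H.dualAutomaton) := by
  have : Nonempty (Fin n) := ⟨⟨0, hn⟩⟩
  have hc := hH.syncCore
  have hmin := hH.minimal
  obtain ⟨N, hN, hid⟩ := (Transducer.finiteOrder_iff hc.isSynchronizing).1 hfin
  have hi := H.isSynchronizing_infPow hc hN hid
  have hB := H.isSyncCore_dualAutomaton hi
  obtain ⟨φ, hact, emb, hφ⟩ := Transducer.exists_dualAction hc hH.invertible hfin
  have hind := hφ.inducedFrom hc.isSynchronizing hB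
  refine ⟨H.isLeast_zeroLevel hi, H.dualAutomaton_step_cls hi, ⟨φ, hact, fun ψ => ⟨fun hψ => ?_,
    fun hψ => hψ ▸ hind⟩⟩, ⟨⟨φ, hind⟩, fun r hr hsup => ?_⟩, fun S _ A hA => ?_,
    fun S _ A hA => ?_⟩
  · obtain ⟨g, -, hg⟩ := hψ.exists_isHom hc hmin hfin hφ
    have hgid : g = id := Automaton.hom_unique hB hB.isSynchronizing hg.step fun _ _ => rfl
    subst hgid
    exact DigraphAut.ext_of_edge hg.vertex fun c x => (hg.edge c x).symm
  · obtain ⟨ψ, hψ⟩ := hsup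
    obtain ⟨g, -, hg⟩ := hψ.exists_isHom hc hmin hfin hφ
    -- If a folding is a support, it maps back to the dual automaton; the composite endomorphism
    -- must be the identity, so nothing was identified.
    have hgid : (fun c => g (Quotient.mk r c)) = id :=
      Automaton.hom_unique hB hB.isSynchronizing (fun x c => hg.step x (Quotient.mk r c))
        fun _ _ => rfl
    refine le_antisymm (fun c d hcd => ?_) bot_le
    have h1 := congrFun hgid c
    have h2 := congrFun hgid d
    have h3 : (Quotient.mk r c) = Quotient.mk r d := Quotient.sound hcd
    rw [h3, h2] at h1
    exact h1.symm
  · obtain ⟨⟨ψ, hψ⟩, hm⟩ := hA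
    obtain ⟨g, hs, hg⟩ := hψ.exists_isHom hc hmin hfin hφ
    -- The folding by the kernel of `g` is isomorphic to the dual automaton, hence a support, so
    -- minimality makes the kernel trivial.
    have hbot := hm _ (Automaton.isFolding_ker hg.step)
      (Supports.of_iso ⟨φ, hind⟩ (Automaton.fold_ker_iso hg.step hs))
    exact ⟨Equiv.ofBijective g ⟨Setoid.ker_eq_bot_iff.1 hbot, hs⟩, hg.step⟩
  · obtain ⟨ψ, hψ⟩ := hA
    obtain ⟨g, hs, hg⟩ := hψ.exists_isHom hc hmin hfin hφ
    exact ⟨_, _, Automaton.fold_ker_iso hg.step hs⟩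

end DualAction

/-! Automorphisms of the shift -/

section Homeomorph

variable {X : Type u} {Q : Type v}

/-- The Curtis–Hedlund–Lyndon argument: the last letter of the image is locally constant, and
compactness makes the number of relevant letters uniform. -/
theorem exists_hasMemory_of_continuous [Finite X] [TopologicalSpace X] [DiscreteTopology X]
    {F : (ℕ → X) → (ℕ → X)} (hc : Continuous F) (hF : ∀ x, F (shiftMap x) = shiftMap (F x)) :
    ∃ k, HasMemory F k := by
  have hloc : ∀ x : ℕ → X, ∃ k, ∀ y, Agree k x y → F y 0 = F x 0 := by
    intro x
    have ho : IsOpen {y | F y 0 = F x 0} :=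
      (isOpen_discrete {F x 0}).preimage ((continuous_apply 0).comp hc)
    obtain ⟨I, u, hu, hI⟩ := isOpen_pi_iff.1 ho x rfl
    refine ⟨I.sup id + 1, fun y hy => hI ?_⟩
    intro i hi
    rw [← hy i (Nat.lt_succ_of_le (Finset.le_sup (f := id) hi))]
    exact (hu i hi).2
  choose k hk using hloc
  obtain ⟨t, -, ht⟩ := (isCompact_univ (X := ℕ → X)).elim_nhds_subcover
    (fun x => {y | Agree (k x) x y}) (fun x _ => by
      have : {y | Agree (k x) x y} = (Finset.range (k x) : Set ℕ).pi fun i => {x i} := by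
        ext y; simp [Agree, Set.mem_pi, eq_comm]
      rw [this]
      exact (isOpen_set_pi (Finset.finite_toSet _) fun i _ => isOpen_discrete _).mem_nhds
        fun i _ => rfl)
  refine ⟨t.sup k, hasMemory_of_zero hF fun x y hxy => ?_⟩
  obtain ⟨z, hz, hzx⟩ := Set.mem_iUnion₂.1 (ht (Set.mem_univ x))
  have hzx : Agree (k z) z x := hzx
  rw [hk z x hzx, hk z y (hzx.trans (hxy.mono (Finset.le_sup hz)))]

/-- The map that `F` induces on the continuations of the left-infinite sequence `x`. -/
def localMap (F : (ℕ → X) → (ℕ → X)) (x w : ℕ → X) (i : ℕ) : X := F (appendInf x w (i + 1)) 0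

theorem appendInf_pushSeq (x w : ℕ → X) (a : X) (i : ℕ) :
    appendInf x (pushSeq w a) (i + 1) = appendInf (pushSeq x a) w i := by
  induction i with
  | zero => rfl
  | succ i ih => rw [appendInf, ih]; rfl

/-- The local map after one more letter is a residual of the earlier one, so local maps can serve as
states. -/
theorem localMap_pushSeq (F : (ℕ → X) → (ℕ → X)) (x w : ℕ → X) (a : X) (i : ℕ) :
    localMap F (pushSeq x a) w i = localMap F x (pushSeq w a) (i + 1) := by
  rw [localMap, localMap, appendInf_pushSeq]

theorem Agree.appendInf {j : ℕ} {x y : ℕ → X} (h : Agree j x y) (w : ℕ → X) (i : ℕ) :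
    Agree (j + i) (appendInf x w i) (appendInf y w i) := by
  induction i with
  | zero => exact h
  | succ i ih => exact ih.pushSeq _

theorem HasMemory.localMap_congr {F : (ℕ → X) → (ℕ → X)} {k : ℕ} (h : HasMemory F k)
    {x y : ℕ → X} (hxy : Agree k x y) : localMap F x = localMap F y := by
  funext w i
  exact h 1 _ _ ((hxy.appendInf w (i + 1)).mono (by omega)) 0 one_pos

theorem HasMemory.finite_range_localMap [Finite X] [Nonempty X] {F : (ℕ → X) → (ℕ → X)} {k : ℕ}
    (h : HasMemory F k) : (Set.range (localMap F)).Finite := by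
  classical
  refine (Set.finite_range fun v : Fin k → X => localMap F fun i =>
    if hi : i < k then v ⟨i, hi⟩ else Classical.arbitrary X).subset ?_
  rintro _ ⟨x, rfl⟩
  exact ⟨fun i => x i, h.localMap_congr fun i hi => by simp [hi]⟩

/-- A transformation of the shift space with finite memory is represented by a minimal core
synchronizing transducer. -/
theorem HasMemory.exists_transducer [Finite X] [Nonempty X] {F : (ℕ → X) → (ℕ → X)} {k : ℕ}
    (h : HasMemory F k) (hF : ∀ x, F (shiftMap x) = shiftMap (F x)) :
    ∃ (m : ℕ) (T : Transducer X (Fin m)) (st : (ℕ → X) → Fin m), Function.Surjective st ∧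
      (∀ x a, T.step a (st x) = st (pushSeq x a)) ∧
      (∀ x a, T.out a (st x) = F (pushSeq x a) 0) ∧
      (∀ x y, Agree k x y → st x = st y) ∧ T.IsMinimal ∧
      ∃ hc : T.toAutomaton.IsSyncCore, T.mapOf hc.isSynchronizing = F := by
  have := h.finite_range_localMap.to_subtype
  obtain ⟨m, ⟨e⟩⟩ := Finite.exists_equiv_fin (Set.range (localMap F))
  obtain ⟨st, hst⟩ : ∃ st : (ℕ → X) → Fin m, st = fun x => e ⟨localMap F x, x, rfl⟩ := ⟨_, rfl⟩
  have hs : Function.Surjective st := by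
    intro q
    obtain ⟨⟨_, x, rfl⟩, hx⟩ := e.surjective q
    exact ⟨x, by rw [hst]; exact hx⟩
  have heq : ∀ x y, st x = st y ↔ localMap F x = localMap F y := by
    intro x y
    rw [hst]
    exact e.injective.eq_iff.trans Subtype.mk_eq_mk
  obtain ⟨T, hT⟩ : ∃ T : Transducer X (Fin m), T = ⟨⟨fun a q =>
    st (pushSeq (Function.surjInv hs q) a)⟩, fun a q => F (pushSeq (Function.surjInv hs q) a) 0⟩ :=
    ⟨_, rfl⟩
  have hrep : ∀ x, localMap F (Function.surjInv hs (st x)) = localMap F x := fun x =>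
    (heq _ _).1 (Function.surjInv_eq hs _)
  have hstep : ∀ x a, T.step a (st x) = st (pushSeq x a) := by
    intro x a
    rw [hT]
    refine (heq _ _).2 ?_
    funext w i
    rw [localMap_pushSeq, localMap_pushSeq, hrep]
  have hout : ∀ x a, T.out a (st x) = F (pushSeq x a) 0 := by
    intro x a
    rw [hT]
    exact congrFun (congrFun (hrep x) fun _ => a) 0
  have hcongr : ∀ x y, Agree k x y → st x = st y := fun x y hxy =>
    (heq x y).2 (h.localMap_congr hxy)
  have hrun : ∀ l x, T.run l (st x) = st (appendSeq x l) := by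
    intro l
    induction l with
    | nil => intro x; rfl
    | cons a l ih => intro x; rw [Automaton.run, hstep, ih]; rfl
  have hread : ∀ x q, T.run (pastList x k) q = st x := by
    intro x q
    obtain ⟨y, rfl⟩ := hs q
    rw [hrun]
    apply hcongr
    conv_rhs => rw [← appendSeq_pastList x k]
    exact (agree_appendSeq _ _ _).mono (length_pastList x k).ge
  have hsync : T.toAutomaton.IsSynchronizing := ⟨k, Automaton.syncAt_of_run_pastList hread⟩
  have hpast := Automaton.pastState_eq_of_run_pastList hsync hread
  have hc : T.toAutomaton.IsSyncCore := by
    rw [Automaton.isSyncCore_iff hsync, hpast]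
    exact hs
  have hmap : T.mapOf hc.isSynchronizing = F := by
    funext x i
    show T.out (x i) (T.pastState hsync (shiftMap^[i + 1] x)) = _
    rw [hpast, hout]
    have e1 : pushSeq (shiftMap^[i + 1] x) (x i) = shiftMap^[i] x := by
      rw [Function.iterate_succ_apply']
      have := pushSeq_shiftMap (shiftMap^[i] x)
      rwa [show (shiftMap^[i] x) 0 = x i by rw [shiftMap_iterate]; simp] at this
    rw [e1, map_iterate_shiftMap hF, shiftMap_iterate]
    simp
  refine ⟨m, T, st, hs, hstep, hout, hcongr, fun p q hpq => ?_, hc, hmap⟩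
  obtain ⟨x, rfl⟩ := hs p
  obtain ⟨y, rfl⟩ := hs q
  -- The `ω`-map of a state is the very local map that names it, which gives minimality.
  refine (heq x y).2 ?_
  funext w i
  have := congrFun (congrFun hpq w) i
  have hx : ∀ x, st x = T.pastState hc.isSynchronizing x := fun x => (congrFun hpast x).symm
  rw [hx, hx, T.omegaMap_pastState, T.omegaMap_pastState, hmap] at this
  exact this

theorem Transducer.inverse_step_out (T : Transducer X Q) (h : T.IsInvertible) (a : X) (q : Q) :
    (T.inverse h).step (T.out a q) q = T.step a q := by
  show T.step ((Equiv.ofBijective _ (h q)).symm (T.out a q)) q = _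
  congr 1
  exact (Equiv.ofBijective _ (h q)).symm_apply_apply a

/-- Every automorphism of the shift of finite order is represented by an element of finite order
of `H_n`. -/
theorem exists_isHn_of_homeomorph {n : ℕ} (hn : 1 ≤ n) (φ : (ℕ → Fin n) ≃ₜ (ℕ → Fin n))
    (hφ : ∀ x, φ (shiftMap x) = shiftMap (φ x)) (hfin : IsOfFinOrder φ) :
    ∃ (m : ℕ) (H : Transducer (Fin n) (Fin m)), IsHn H ∧ H.FiniteOrder ∧ H.Induces φ := by
  have : Nonempty (Fin n) := ⟨⟨0, hn⟩⟩
  have hφ' : ∀ x, φ.symm (shiftMap x) = shiftMap (φ.symm x) := by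
    intro x
    rw [φ.symm_apply_eq, hφ, φ.apply_symm_apply]
  obtain ⟨k, hk⟩ := exists_hasMemory_of_continuous φ.continuous hφ
  obtain ⟨k', hk'⟩ := exists_hasMemory_of_continuous φ.symm.continuous hφ'
  obtain ⟨m, T, st, hs, hstep, hout, hcongr, hmin, hc, hmap⟩ := hk.exists_transducer hφ
  have hpush : ∀ x a, φ (pushSeq x a) = pushSeq (φ x) (T.out a (st x)) := fun x a =>
    pushSeq_ext (hout x a).symm (by rw [← hφ]; rfl)
  have hinv : T.IsInvertible := by
    intro q
    obtain ⟨x, rfl⟩ := hs q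
    refine Finite.injective_iff_bijective.1 fun a b hab => ?_
    have hab : T.out a (st x) = T.out b (st x) := hab
    have := φ.injective ((hpush x a).trans (hab ▸ (hpush x b).symm))
    exact congrFun this 0
  -- While the inverse transducer reads `y`, its state is the one `T` reaches on the preimage of
  -- `y`.
  have hinvstep : ∀ b y, (T.inverse hinv).step b (st (φ.symm y)) = st (φ.symm (pushSeq y b)) := by
    intro b y
    obtain ⟨a, rfl⟩ := (hinv (st (φ.symm y))).2 b
    rw [T.inverse_step_out, hstep]
    congr 1
    rw [φ.eq_symm_apply, hpush, φ.apply_symm_apply]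
  have hinvrun : ∀ l y, (T.inverse hinv).run l (st (φ.symm y)) = st (φ.symm (appendSeq y l)) := by
    intro l
    induction l with
    | nil => intro y; rfl
    | cons a l ih => intro y; rw [Automaton.run, hinvstep, ih]; rfl
  have hne : Nonempty (Fin m) := ⟨st fun _ => Classical.arbitrary _⟩
  refine ⟨m, T, ⟨hinv, hmin, hc, k + k', Automaton.syncAt_of_run_eq fun l hl p q => ?_⟩, ?_, ?_⟩
  · obtain ⟨x, rfl⟩ := hs p
    obtain ⟨y, rfl⟩ := hs q
    -- Agreement on `k + k'` letters leaves agreement on `k` letters of the preimages, and these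
    -- determine the state.
    rw [← φ.symm_apply_apply x, ← φ.symm_apply_apply y, hinvrun, hinvrun]
    exact hcongr _ _ (hk' _ _ _ ((agree_appendSeq _ _ l).mono hl.ge))
  · rw [Transducer.finiteOrder_iff hc.isSynchronizing, hmap]
    obtain ⟨N, hN, hid⟩ := isOfFinOrder_iff_pow_eq_one.1 hfin
    refine ⟨N, hN, ?_⟩
    have key : ∀ N : ℕ, ⇑(φ ^ N) = φ^[N] := by
      intro N
      induction N with
      | zero => rfl
      | succ N ih => rw [pow_succ, Function.iterate_succ, ← ih]; rfl
    rw [← key, hid]; rfl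
  · exact Transducer.induces_iff.2 ⟨hc.isSynchronizing, hmap.symm⟩

end Homeomorph

/-! Rank functions that certify synchronization -/

section Rank

variable {X : Type u} {Q : Type v} {S : Type w}

/-- The rank is the least length from which on `P` holds. Its local inequalities turn an eventual
property into one checkable on a finite table; truncated subtraction keeps rank `0` at `0`. -/
theorem Automaton.exists_rank (A : Automaton X Q) {P : Q → Prop} {L : ℕ}
    (h : ∀ l : List X, L ≤ l.length → ∀ q, P (A.run l q)) :
    ∃ r : Q → ℕ, ∀ q, (r q = 0 → P q) ∧ ∀ x, r (A.step x q) ≤ r q - 1 := by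
  have hne : ∀ q, {j | ∀ l : List X, j ≤ l.length → P (A.run l q)}.Nonempty := fun q =>
    ⟨L, fun l hl => h l hl q⟩
  refine ⟨fun q => sInf {j | ∀ l : List X, j ≤ l.length → P (A.run l q)}, fun q =>
    ⟨fun h0 => Nat.sInf_mem (hne q) [] h0.le, fun x => Nat.sInf_le fun l hl => ?_⟩⟩
  exact Nat.sInf_mem (hne q) (x :: l) (by
    change sInf _ - 1 ≤ _ at hl
    rw [List.length_cons]; omega)

theorem Automaton.exists_level_of_rank [Finite Q] {A : Automaton X Q} {P : Q → Prop} {r : Q → ℕ}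
    (h : ∀ q, (r q = 0 → P q) ∧ ∀ x, r (A.step x q) ≤ r q - 1) :
    ∃ L, ∀ l : List X, L ≤ l.length → ∀ q, P (A.run l q) := by
  have key : ∀ (l : List X) q, r (A.run l q) ≤ r q - l.length := by
    intro l
    induction l with
    | nil => intro q; exact le_rfl
    | cons a l ih =>
      intro q
      have h1 := ih (A.step a q)
      have h2 := (h q).2 a
      rw [Automaton.run, List.length_cons]
      omega
  obtain ⟨L, hL⟩ := (Set.finite_range r).bddAbove
  refine ⟨L, fun l hl q => (h _).1 ?_⟩
  have h1 := key l q
  have h2 : r q ≤ L := hL ⟨q, rfl⟩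
  omega

/-- Two automata run in parallel. -/
def Automaton.pair (A : Automaton X Q) (B : Automaton X S) : Automaton X (Q × S) where
  step x q := (A.step x q.1, B.step x q.2)

theorem Automaton.run_pair (A : Automaton X Q) (B : Automaton X S) (l : List X) (q : Q × S) :
    (A.pair B).run l q = (A.run l q.1, B.run l q.2) := by
  induction l generalizing q with
  | nil => rfl
  | cons a l ih => exact ih _

theorem Automaton.IsSynchronizing.exists_rank {A : Automaton X Q} (h : A.IsSynchronizing) :
    ∃ r : Q × Q → ℕ, ∀ q, (r q = 0 → q.1 = q.2) ∧
      ∀ x, r (A.step x q.1, A.step x q.2) ≤ r q - 1 := by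
  obtain ⟨L, hL⟩ := h
  refine (A.pair A).exists_rank (P := fun q => q.1 = q.2) (L := L) fun l hl q => ?_
  rw [Automaton.run_pair]
  exact hL.run_eq l hl _ _

/-- If every state has a predecessor, every state ends a path of any prescribed length, in
particular one labelled by a resetting word. -/
theorem Automaton.isSyncCore_of_rank [Nonempty X] [Finite Q] [Nonempty Q] {A : Automaton X Q}
    {r : Q × Q → ℕ} (h : ∀ q, (r q = 0 → q.1 = q.2) ∧
      ∀ x, r (A.step x q.1, A.step x q.2) ≤ r q - 1)
    (hs : ∀ q, ∃ p x, A.step x p = q) : A.IsSyncCore := by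
  obtain ⟨L, hL⟩ := Automaton.exists_level_of_rank (A := A.pair A) h
  simp only [Automaton.run_pair] at hL
  have hsync : A.IsSynchronizing := ⟨L, Automaton.syncAt_of_run_eq fun l hl p q =>
    hL l hl.ge (p, q)⟩
  rw [Automaton.isSyncCore_iff hsync]
  intro q
  have hpre : ∀ k, ∃ (l : List X) (p : Q), l.length = k ∧ A.run l p = q := by
    intro k
    induction k with
    | zero => exact ⟨[], q, rfl, rfl⟩
    | succ k ih =>
      obtain ⟨l, p, hl, hp⟩ := ih
      obtain ⟨p', x, rfl⟩ := hs p
      exact ⟨x :: l, p', by rw [List.length_cons, hl], hp⟩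
  obtain ⟨l, p, hl, rfl⟩ := hpre L
  refine ⟨appendSeq (fun _ => Classical.arbitrary X) l, ?_⟩
  rw [Automaton.pastState_appendSeq]
  exact hL l hl.ge (_, p)

theorem SameMap.exists_rank [Nonempty X] {T : Transducer X Q} {U : Transducer X S}
    (h : SameMap T U) : ∃ r : Q × S → ℕ, ∀ q, (r q = 0 → ∀ x, T.out x q.1 = U.out x q.2) ∧
      ∀ x, r (T.step x q.1, U.step x q.2) ≤ r q - 1 := by
  obtain ⟨hT, hU, e⟩ := sameMap_iff.1 h
  obtain ⟨K, hK⟩ := T.exists_run_pastList hT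
  obtain ⟨L, hL⟩ := U.exists_run_pastList hU
  refine (T.toAutomaton.pair U.toAutomaton).exists_rank
    (P := fun q => ∀ x, T.out x q.1 = U.out x q.2) (L := K + L) fun l hl q x => ?_
  have hl' := pastList_appendSeq (fun _ => Classical.arbitrary X) l
  rw [Automaton.run_pair, ← hl', hK _ (by omega), hL _ (by omega)]
  exact congrFun (congrFun e (pushSeq (appendSeq (fun _ => Classical.arbitrary X) l) x)) 0

theorem sameMap_of_rank [Finite Q] [Finite S] {T : Transducer X Q} {U : Transducer X S}
    (hT : T.toAutomaton.IsSynchronizing) (hU : U.toAutomaton.IsSynchronizing) {r : Q × S → ℕ}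
    (h : ∀ q, (r q = 0 → ∀ x, T.out x q.1 = U.out x q.2) ∧
      ∀ x, r (T.step x q.1, U.step x q.2) ≤ r q - 1) : SameMap T U := by
  refine sameMap_iff.2 ⟨hT, hU, ?_⟩
  obtain ⟨M, hM⟩ := Automaton.exists_level_of_rank (A := T.toAutomaton.pair U.toAutomaton)
    (P := fun q => ∀ x, T.out x q.1 = U.out x q.2) h
  simp only [Automaton.run_pair] at hM
  obtain ⟨K, hK⟩ := T.exists_run_pastList hT
  obtain ⟨L, hL⟩ := U.exists_run_pastList hU
  funext x i
  have := hM (pastList (shiftMap^[i + 1] x) (M + K + L)) (by rw [length_pastList]; omega)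
    (T.pastState hT x, U.pastState hU x) (x i)
  rwa [hK _ (by omega), hL _ (by omega)] at this

/-! Separation of the states under the transducer and the automorphism -/

/-- The states `p` and `q` are sent to states with different outputs by `d` moves, each of which
reads a letter or applies `ψ`. -/
def DigraphAut.SepIn {A : Automaton X Q} (ψ : DigraphAut A) : ℕ → Q → Q → Prop
  | 0, p, q => ∃ x, ψ.transducer.out x p ≠ ψ.transducer.out x q
  | d + 1, p, q => ψ.SepIn d (ψ.vertex p) (ψ.vertex q) ∨
      ∃ x, ψ.SepIn d (A.step x p) (A.step x q)

variable {A : Automaton X Q} {ψ : DigraphAut A}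

theorem DigraphAut.SepIn.ne {d : ℕ} {p q : Q} (h : ψ.SepIn d p q) : p ≠ q := by
  rintro rfl
  induction d generalizing p with
  | zero => obtain ⟨x, hx⟩ := h; exact hx rfl
  | succ d ih =>
    obtain h | ⟨x, h⟩ := h
    · exact ih h
    · exact ih h

theorem DigraphAut.SepIn.of_iterate {d t : ℕ} {p q : Q}
    (h : ψ.SepIn d (ψ.vertex^[t] p) (ψ.vertex^[t] q)) : ψ.SepIn (d + t) p q := by
  induction t generalizing p q with
  | zero => exact h
  | succ t ih => exact Or.inl (ih h)

theorem DigraphAut.sepIn_of_omegaMap_ne {p q : Q} {w : ℕ → X} {i : ℕ}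
    (h : ψ.transducer.omegaMap p w i ≠ ψ.transducer.omegaMap q w i) : ψ.SepIn i p q := by
  induction i generalizing p q w with
  | zero => exact ⟨w 0, h⟩
  | succ i ih =>
    refine Or.inr ⟨w 0, ih (w := shiftMap w) ?_⟩
    have e : ∀ p, ψ.transducer.omegaMap p w (i + 1) =
        ψ.transducer.omegaMap (A.step (w 0) p) (shiftMap w) i := by
      intro p
      have := congrFun (ψ.transducer.omegaMap_cons p (w 0) (shiftMap w)) (i + 1)
      have e : (fun i => Nat.casesOn i (w 0) (shiftMap w) : ℕ → X) = w := pushSeq_shiftMap w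
      rw [e] at this
      exact this
    rwa [e, e] at h

/-- The rank is the least number of separating moves. On equal states it has the junk value `0`, so
a letter move must also record that the new states differ; `ψ` is injective and needs no such
clause. -/
theorem DigraphAut.exists_separation (h : ∀ p q, p ≠ q → ∃ d, ψ.SepIn d p q) :
    ∃ r : Q × Q → ℕ, ∀ q, q.1 ≠ q.2 → (∃ x, ψ.transducer.out x q.1 ≠ ψ.transducer.out x q.2) ∨
      r (ψ.vertex q.1, ψ.vertex q.2) < r q ∨
      ∃ x, A.step x q.1 ≠ A.step x q.2 ∧ r (A.step x q.1, A.step x q.2) < r q := by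
  refine ⟨fun q => sInf {d | ψ.SepIn d q.1 q.2}, fun q hq => ?_⟩
  have hm : sInf {d | ψ.SepIn d q.1 q.2} ∈ {d | ψ.SepIn d q.1 q.2} := Nat.sInf_mem (h _ _ hq)
  cases hd : sInf {d | ψ.SepIn d q.1 q.2} with
  | zero => rw [hd] at hm; exact Or.inl hm
  | succ d =>
    rw [hd] at hm
    obtain hm | ⟨x, hm⟩ := hm
    · exact Or.inr (Or.inl ((Nat.lt_succ_of_le (Nat.sInf_le hm)).trans_eq hd.symm))
    · exact Or.inr (Or.inr ⟨x, hm.ne, (Nat.lt_succ_of_le (Nat.sInf_le hm)).trans_eq hd.symm⟩)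

/-- By descent on the rank: distinct states with one image would either write different letters or
yield such a pair of smaller rank. -/
theorem DigraphAut.IsHom.injective_of_separation {B : Automaton X S} {φ : DigraphAut B}
    {g : Q → S} (hg : ψ.IsHom φ g) {r : Q × Q → ℕ} (hr : ∀ q : Q × Q, q.1 ≠ q.2 →
      (∃ x, ψ.transducer.out x q.1 ≠ ψ.transducer.out x q.2) ∨
      r (ψ.vertex q.1, ψ.vertex q.2) < r q ∨
      ∃ x, A.step x q.1 ≠ A.step x q.2 ∧ r (A.step x q.1, A.step x q.2) < r q) :
    Function.Injective g := by
  have key : ∀ (d : ℕ) (p q : Q), r (p, q) < d → p ≠ q → g p ≠ g q := by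
    intro d
    induction d with
    | zero => intro p q hd; omega
    | succ d ih =>
      intro p q hd hpq e
      obtain ⟨x, hx⟩ | h | ⟨x, hx, h⟩ := hr (p, q) hpq
      · exact hx (by rw [hg.out, hg.out, e])
      · refine ih _ _ (lt_of_lt_of_le h (Nat.le_of_lt_succ hd)) (ψ.vertex.injective.ne hpq) ?_
        rw [hg.vertex, hg.vertex, e]
      · refine ih _ _ (lt_of_lt_of_le h (Nat.le_of_lt_succ hd)) hx ?_
        rw [hg.step, hg.step, e]
  intro p q e
  by_contra hpq
  exact key _ p q (Nat.lt_succ_self _) hpq e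

theorem Transducer.omegaMap_map {T : Transducer X Q} {U : Transducer X S} {g : Q → S}
    (hg : ∀ x q, g (T.step x q) = U.step x (g q)) (ho : ∀ x q, T.out x q = U.out x (g q)) (q : Q) :
    T.omegaMap q = U.omegaMap (g q) := by
  funext w i
  have key : ∀ i, g (T.stateAt q w i) = U.stateAt (g q) w i := by
    intro i
    induction i with
    | zero => rfl
    | succ i ih => rw [Transducer.stateAt, hg, ih]; rfl
  rw [Transducer.omegaMap, ho, key]; rfl

/-- Distinct states differ in some coordinate `t` of the embedding. After `t` applications of `ψ`
they lie over distinct states of `T`, which some word separates by minimality. -/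
theorem Transducer.IsDualEmbedding.exists_sepIn {T : Transducer X S} (hmin : T.IsMinimal)
    {φ : DigraphAut T.dualAutomaton} {emb : T.DualState → ℕ → S} (hφ : T.IsDualEmbedding φ emb)
    {g : Q → T.DualState} (hg : ψ.IsHom φ g) (hi : Function.Injective g) {p q : Q} (hpq : p ≠ q) :
    ∃ d, ψ.SepIn d p q := by
  have hne := fun e => hpq (hi (hφ.injective e))
  obtain ⟨t, ht⟩ := Function.ne_iff.1 hne
  have hiter : ∀ t p i, emb (g (ψ.vertex^[t] p)) i = emb (g p) (i + t) := by
    intro t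
    induction t with
    | zero => intro p i; rfl
    | succ t ih =>
      intro p i
      rw [Function.iterate_succ_apply, ih, hg.vertex, hφ.vertex]; rfl
  have hom := Transducer.omegaMap_map (T := ψ.transducer) (U := T) (g := fun q => emb (g q) 0)
    (fun x a => by
      show emb (g (A.step x a)) 0 = _
      rw [hg.step, hφ.step]; rfl)
    (fun x a => by rw [hg.out, hφ.out])
  have hω : ψ.transducer.omegaMap (ψ.vertex^[t] p) ≠ ψ.transducer.omegaMap (ψ.vertex^[t] q) := by
    rw [hom, hom]
    intro e
    have := hmin _ _ e
    rw [hiter, hiter, zero_add] at this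
    exact ht this
  obtain ⟨w, hw⟩ := Function.ne_iff.1 hω
  obtain ⟨i, hi⟩ := Function.ne_iff.1 hw
  exact ⟨_, (DigraphAut.sepIn_of_omegaMap_ne hi).of_iterate⟩

end Rank

/-! Tables and the search for certificates -/

section Tables

/-- The entry in row `i` and column `j` of a table. -/
def tableEntry (t : List (List ℕ)) (i j : ℕ) : ℕ := (t.getD i []).getD j 0

theorem getD_ofFn {s : ℕ} (f : Fin s → ℕ) (q : Fin s) : (List.ofFn f).getD q 0 = f q := by
  simp

theorem tableEntry_ofFn {s n : ℕ} (f : Fin s → Fin n → ℕ) (q : Fin s) (x : Fin n) :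
    tableEntry (List.ofFn fun q => List.ofFn fun x => f q x) q x = f q x := by
  simp [tableEntry]

theorem ofFn_getD {s : ℕ} {l : List ℕ} (h : l.length = s) :
    (List.ofFn fun q : Fin s => l.getD q 0) = l := by
  subst h
  exact List.ext_getElem (by simp) fun i h1 h2 => by simp

/-- The length conditions exclude superfluous entries, so certified tables are literally the code of
the object they describe. -/
theorem ofFn_tableEntry {s n : ℕ} {t : List (List ℕ)} (h : t.length = s)
    (hr : ∀ q < s, (t.getD q []).length = n) :
    (List.ofFn fun q : Fin s => List.ofFn fun x : Fin n => tableEntry t q x) = t := by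
  subst h
  refine List.ext_getElem (by simp) fun i h1 h2 => ?_
  rw [List.getElem_ofFn]
  have := ofFn_getD (hr i h2)
  simp only [tableEntry]
  rw [this]
  simp [h2]

/-- The tables `(n, s, A, B)` and the list `v` describe a core synchronizing automaton with a
digraph automorphism that is a minimal support of the transducer with tables `(n, m, S, O)`. This
is certified by the rank functions `r₁` (synchronization), `r₂` (equality of the represented maps)
and `r₃` (separation of the states). -/
def IsCertificate (n m : ℕ) (S O : List (List ℕ)) (n' s : ℕ) (A B : List (List ℕ)) (v : List ℕ)
    (r₁ r₂ r₃ : List (List ℕ)) : Prop :=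
  (n' = n ∧ 0 < s ∧ A.length = s ∧ B.length = s ∧ v.length = s) ∧
  (∀ q < s, (A.getD q []).length = n ∧ (B.getD q []).length = n ∧ v.getD q 0 < s) ∧
  (∀ q < s, ∀ x < n, tableEntry A q x < s ∧ tableEntry B q x < n ∧
    tableEntry A (v.getD q 0) (tableEntry B q x) = v.getD (tableEntry A q x) 0) ∧
  (∀ p < s, ∀ q < s, v.getD p 0 = v.getD q 0 → p = q) ∧
  (∀ q < s, ∀ x < n, ∀ y < n, tableEntry B q x = tableEntry B q y → x = y) ∧
  (∀ q < s, ∃ p < s, ∃ x < n, tableEntry A p x = q) ∧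
  (∀ p < s, ∀ q < s, (tableEntry r₁ p q = 0 → p = q) ∧
    ∀ x < n, tableEntry r₁ (tableEntry A p x) (tableEntry A q x) ≤ tableEntry r₁ p q - 1) ∧
  (∀ p < m, ∀ q < s, (tableEntry r₂ p q = 0 → ∀ x < n, tableEntry O p x = tableEntry B q x) ∧
    ∀ x < n, tableEntry r₂ (tableEntry S p x) (tableEntry A q x) ≤ tableEntry r₂ p q - 1) ∧
  (∀ p < s, ∀ q < s, p ≠ q → (∃ x < n, tableEntry B p x ≠ tableEntry B q x) ∨
    tableEntry r₃ (v.getD p 0) (v.getD q 0) < tableEntry r₃ p q ∨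
    ∃ x < n, tableEntry A p x ≠ tableEntry A q x ∧
      tableEntry r₃ (tableEntry A p x) (tableEntry A q x) < tableEntry r₃ p q)

/-! ### Primitive recursiveness of checking a certificate -/

section Primrec

variable {α : Type*} [Primcodable α]

theorem Primrec.tableEntry {t : α → List (List ℕ)} {i j : α → ℕ} (ht : Primrec t) (hi : Primrec i)
    (hj : Primrec j) : Primrec fun a => tableEntry (t a) (i a) (j a) :=
  (Primrec.list_getD 0).comp ((Primrec.list_getD []).comp ht hi) hj

theorem PrimrecPred.ball_lt {f : α → ℕ} {P : α → ℕ → Prop} (hf : Primrec f)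
    (hP : PrimrecPred fun z : α × ℕ => P z.1 z.2) : PrimrecPred fun a => ∀ x < f a, P a x :=
  ((PrimrecRel.forall_mem_list (R := fun x a => P a x)
    (hP.comp (Primrec.snd.pair Primrec.fst))).comp (Primrec.list_range.comp hf) Primrec.id).of_eq
      fun a => by simp

theorem PrimrecPred.bex_lt {f : α → ℕ} {P : α → ℕ → Prop} (hf : Primrec f)
    (hP : PrimrecPred fun z : α × ℕ => P z.1 z.2) : PrimrecPred fun a => ∃ x < f a, P a x :=
  ((PrimrecRel.exists_mem_list (R := fun x a => P a x)
    (hP.comp (Primrec.snd.pair Primrec.fst))).comp (Primrec.list_range.comp hf) Primrec.id).of_eq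
      fun a => by simp

theorem PrimrecPred.imp {P R : α → Prop} (hP : PrimrecPred P) (hR : PrimrecPred R) :
    PrimrecPred fun a => P a → R a :=
  (hP.not.or hR).of_eq fun _ => imp_iff_not_or.symm

/-- The finite data of a transducer. -/
abbrev TransducerCode : Type := ℕ × ℕ × List (List ℕ) × List (List ℕ)

/-- The finite data of an automaton with a digraph automorphism, with three tables of ranks. -/
abbrev CertificateCode : Type :=
  (TransducerCode × List ℕ) × List (List ℕ) × List (List ℕ) × List (List ℕ)

-- All quantifiers in a certificate are bounded by the sizes `n`, `m` and `s`.
set_option maxHeartbeats 400000 in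
theorem primrecPred_isCertificate : PrimrecPred fun z : TransducerCode × CertificateCode =>
    IsCertificate z.1.1 z.1.2.1 z.1.2.2.1 z.1.2.2.2 z.2.1.1.1 z.2.1.1.2.1 z.2.1.1.2.2.1
      z.2.1.1.2.2.2 z.2.1.2 z.2.2.1 z.2.2.2.1 z.2.2.2.2 := by
  unfold IsCertificate
  repeat' first
    | with_reducible refine PrimrecPred.and ?_ ?_
    | with_reducible refine PrimrecPred.or ?_ ?_
    | with_reducible refine PrimrecPred.ball_lt ?_ ?_
    | with_reducible refine PrimrecPred.bex_lt ?_ ?_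
    | with_reducible refine PrimrecPred.not ?_
    | with_reducible refine Primrec.eq.comp ?_ ?_
    | with_reducible refine Primrec.nat_lt.comp ?_ ?_
    | with_reducible refine Primrec.nat_le.comp ?_ ?_
    | with_reducible refine PrimrecPred.imp ?_ ?_
    | with_reducible exact Primrec.const _
    | with_reducible exact Primrec.id
    | with_reducible exact Primrec.fst
    | with_reducible exact Primrec.snd
    | with_reducible refine Primrec.tableEntry ?_ ?_ ?_
    | with_reducible refine Primrec.list_length.comp ?_
    | with_reducible refine Primrec.nat_sub.comp ?_ ?_
    | with_reducible refine (Primrec.list_getD _).comp ?_ ?_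
    | with_reducible refine Primrec.fst.comp ?_
    | with_reducible refine Primrec.snd.comp ?_

end Primrec

end Tables

/-! ### Soundness, completeness and termination of the search -/

section Algorithm

variable {Q : Type v}

theorem tableEntry_ofFn_prod {s m : ℕ} (r : Fin s × Fin m → ℕ) (p : Fin s) (q : Fin m) :
    tableEntry (List.ofFn fun p => List.ofFn fun q => r (p, q)) p q = r (p, q) := by
  simp [tableEntry]

/-- Every certificate describes the automaton of the zero with its automorphism. -/
theorem IsCertificate.exists_iso {n : ℕ} (hn : 1 ≤ n) {H : Transducer (Fin n) Q} (hH : IsHn H)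
    (hfin : H.FiniteOrder) {m : ℕ} {T : Transducer (Fin n) (Fin m)} (hT : SameMap T H)
    {n' s : ℕ} {tA tB : List (List ℕ)} {v : List ℕ} {r₁ r₂ r₃ : List (List ℕ)}
    (h : IsCertificate T.code.1 T.code.2.1 T.code.2.2.1 T.code.2.2.2 n' s tA tB v r₁ r₂ r₃) :
    ∃ (A : Automaton (Fin n) (Fin s)) (ψ : DigraphAut A) (φ : DigraphAut H.dualAutomaton),
      ((n', s, tA, tB), v) = ψ.code ∧ H.IsDualAction φ ∧ ψ.Iso φ := by
  have : Nonempty (Fin n) := ⟨⟨0, hn⟩⟩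
  obtain ⟨φ, hact, emb, hφ⟩ := Transducer.exists_dualAction hH.syncCore hH.invertible hfin
  obtain ⟨⟨hn', hs, hlA, hlB, hlv⟩, hrow, hmaps, hvinj, hBinj, hcore, hr₁, hr₂, hr₃⟩ := h
  have hn' : n' = n := hn'
  subst hn'
  have : Nonempty (Fin s) := ⟨⟨0, hs⟩⟩
  obtain ⟨A, hA⟩ : ∃ A : Automaton (Fin n') (Fin s), ∀ x q, (A.step x q : ℕ) = tableEntry tA q x :=
    ⟨⟨fun x q => ⟨_, (hmaps q q.2 x x.2).1⟩⟩, fun _ _ => rfl⟩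
  obtain ⟨o, ho⟩ : ∃ o : Fin n' → Fin s → Fin n', ∀ x q, (o x q : ℕ) = tableEntry tB q x :=
    ⟨fun x q => ⟨_, (hmaps q q.2 x x.2).2.1⟩, fun _ _ => rfl⟩
  obtain ⟨f, hf⟩ : ∃ f : Fin s → Fin s, ∀ q, (f q : ℕ) = v.getD q 0 :=
    ⟨fun q => ⟨_, (hrow q q.2).2.2⟩, fun _ => rfl⟩
  obtain ⟨ψ, hψv, hψe⟩ := DigraphAut.exists_of_maps A f o
    (fun p q hpq => Fin.ext (hvinj p p.2 q q.2 (by rw [← hf, ← hf, hpq])))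
    (fun q x y hxy => Fin.ext (hBinj q q.2 x x.2 y y.2 (by
      have hxy : o x q = o y q := hxy
      rw [← ho, ← ho, hxy])))
    (fun q x => Fin.ext (by
      rw [hA, hf, ho, hf, hA]
      exact (hmaps q q.2 x x.2).2.2))
  have hout : ∀ x q, ψ.transducer.out x q = o x q := fun x q => congrArg Prod.snd (hψe q x)
  have hcode : ((n', s, tA, tB), v) = ψ.code := by
    refine Prod.ext (Prod.ext rfl (Prod.ext rfl (Prod.ext ?_ ?_))) ?_
    · show tA = List.ofFn fun q => List.ofFn fun x => (A.step x q : ℕ)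
      simp only [hA]
      exact (ofFn_tableEntry hlA fun q hq => (hrow q hq).1).symm
    · show tB = List.ofFn fun q => List.ofFn fun x => (ψ.transducer.out x q : ℕ)
      simp only [hout, ho]
      exact (ofFn_tableEntry hlB fun q hq => (hrow q hq).2.1).symm
    · show v = List.ofFn fun q => (ψ.vertex q : ℕ)
      simp only [hψv, hf]
      exact (ofFn_getD hlv).symm
  have hS : ∀ x p, (T.step x p : ℕ) = tableEntry T.code.2.2.1 p x := fun x p =>
    (tableEntry_ofFn (fun q x => T.step x q) p x).symm
  have hO : ∀ x p, (T.out x p : ℕ) = tableEntry T.code.2.2.2 p x := fun x p =>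
    (tableEntry_ofFn (fun q x => T.out x q) p x).symm
  have hAc : A.IsSyncCore := by
    refine Automaton.isSyncCore_of_rank (r := fun q => tableEntry r₁ q.1 q.2) (fun q =>
      ⟨fun h0 => Fin.ext ((hr₁ q.1 q.1.2 q.2 q.2.2).1 h0), fun x => ?_⟩) fun q => ?_
    · simp only [hA]
      exact (hr₁ q.1 q.1.2 q.2 q.2.2).2 x x.2
    · obtain ⟨p, hp, x, hx, e⟩ := hcore q q.2
      exact ⟨⟨p, hp⟩, ⟨x, hx⟩, Fin.ext ((hA _ _).trans e)⟩
  obtain ⟨hTs, hHs, hTH⟩ := sameMap_iff.1 hT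
  have hTψ : SameMap T ψ.transducer := by
    refine sameMap_of_rank hTs (U := ψ.transducer) hAc.isSynchronizing
      (r := fun q => tableEntry r₂ q.1 q.2) fun q =>
      ⟨fun h0 x => Fin.ext ?_, fun x => ?_⟩
    · rw [hO, hout, ho]
      exact (hr₂ q.1 q.1.2 q.2 q.2.2).1 h0 x x.2
    · show tableEntry r₂ (T.step x q.1) (A.step x q.2) ≤ _
      rw [hS, hA]
      exact (hr₂ q.1 q.1.2 q.2 q.2.2).2 x x.2
  have hind : InducedFrom H ψ := by
    obtain ⟨hTs', hψs, e⟩ := sameMap_iff.1 hTψ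
    exact ⟨hAc, sameMap_iff.2 ⟨hHs, hψs, hTH.symm.trans e⟩⟩
  obtain ⟨g, hgs, hg⟩ := hind.exists_isHom hH.syncCore hH.minimal hfin hφ
  -- `g` is onto because the tables describe a support; the ranks `r₃` show that it identifies
  -- nothing.
  have hgi : Function.Injective g := by
    refine hg.injective_of_separation (r := fun q => tableEntry r₃ q.1 q.2) fun q hq => ?_
    obtain ⟨x, hx, h⟩ | h | ⟨x, hx, h, h'⟩ :=
      hr₃ q.1 q.1.2 q.2 q.2.2 (fun e => hq (Fin.ext e))
    · refine Or.inl ⟨⟨x, hx⟩, fun e => h ?_⟩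
      rw [hout, hout] at e
      have := congrArg Fin.val e
      rwa [ho, ho] at this
    · refine Or.inr (Or.inl ?_)
      simp only [hψv, hf]
      exact h
    · refine Or.inr (Or.inr ⟨⟨x, hx⟩, fun e => h ?_, ?_⟩)
      · have := congrArg Fin.val e
        rwa [hA, hA] at this
      · simp only [hA]
        exact h'
  exact ⟨A, ψ, φ, hcode, hact, hg.iso ⟨hgi, hgs⟩⟩

/-- There is a certificate for every transducer that represents an element of finite order. -/
theorem exists_isCertificate {n : ℕ} (hn : 1 ≤ n) {H : Transducer (Fin n) Q} (hH : IsHn H)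
    (hfin : H.FiniteOrder) {m : ℕ} {T : Transducer (Fin n) (Fin m)} (hT : SameMap T H) :
    ∃ (n' s : ℕ) (tA tB : List (List ℕ)) (v : List ℕ) (r₁ r₂ r₃ : List (List ℕ)),
      IsCertificate T.code.1 T.code.2.1 T.code.2.2.1 T.code.2.2.2 n' s tA tB v r₁ r₂ r₃ := by
  have : Nonempty (Fin n) := ⟨⟨0, hn⟩⟩
  have hc := hH.syncCore
  obtain ⟨φ, -, emb, hφ⟩ := Transducer.exists_dualAction hc hH.invertible hfin
  obtain ⟨N, hN, hid⟩ := (Transducer.finiteOrder_iff hc.isSynchronizing).1 hfin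
  have hB := H.isSyncCore_dualAutomaton (H.isSynchronizing_infPow hc hN hid)
  have hind := hφ.inducedFrom hc.isSynchronizing hB
  obtain ⟨s, ⟨e⟩⟩ := Finite.exists_equiv_fin H.DualState
  obtain ⟨A, hA⟩ : ∃ A : Automaton (Fin n) (Fin s), ∀ x q,
      e.symm (A.step x q) = H.dualAutomaton.step x (e.symm q) :=
    ⟨⟨fun x q => e (H.dualAutomaton.step x (e.symm q))⟩, fun x q => e.symm_apply_apply _⟩
  -- The certificate is the dual automaton itself, renumbered, with its automorphism.
  obtain ⟨ψ, hψ⟩ := DigraphAut.exists_isHom_of_equiv e.symm hA φ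
  have hindψ := hind.of_isHom hψ
  have hAc := hindψ.1
  have : Nonempty (Fin s) := Automaton.nonempty_of_isSynchronizing hAc.isSynchronizing
  have hTψ : SameMap T ψ.transducer := by
    obtain ⟨hTs, hHs, hTH⟩ := sameMap_iff.1 hT
    obtain ⟨hHs', hψs, e⟩ := sameMap_iff.1 hindψ.2
    exact sameMap_iff.2 ⟨hTs, hψs, hTH.trans e⟩
  obtain ⟨r₁, hr₁⟩ := hAc.isSynchronizing.exists_rank
  obtain ⟨r₂, hr₂⟩ := hTψ.exists_rank
  obtain ⟨r₃, hr₃⟩ := ψ.exists_separation fun p q hpq =>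
    hφ.exists_sepIn hH.minimal hψ e.symm.injective hpq
  have hsA := (Automaton.isSyncCore_iff hAc.isSynchronizing).1 hAc
  have hcore : ∀ q, ∃ p x, A.step x p = q := by
    intro q
    obtain ⟨x, rfl⟩ := hsA q
    refine ⟨A.pastState hAc.isSynchronizing (shiftMap x), x 0, ?_⟩
    rw [← Automaton.pastState_pushSeq, pushSeq_shiftMap]
  have hA' := fun (q : Fin s) (x : Fin n) => tableEntry_ofFn (fun q x => A.step x q) q x
  have hB' := fun (q : Fin s) (x : Fin n) => tableEntry_ofFn (fun q x => ψ.transducer.out x q) q x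
  have hS' := fun (q : Fin m) (x : Fin n) => tableEntry_ofFn (fun q x => T.step x q) q x
  have hO' := fun (q : Fin m) (x : Fin n) => tableEntry_ofFn (fun q x => T.out x q) q x
  have hv' := fun (q : Fin s) => getD_ofFn (fun q => (ψ.vertex q : ℕ)) q
  have h₁ := fun p q => tableEntry_ofFn_prod r₁ p q
  have h₂ := fun p q => tableEntry_ofFn_prod r₂ p q
  have h₃ := fun p q => tableEntry_ofFn_prod r₃ p q
  have hedge : Function.Injective ψ.edge := ψ.edge.injective
  refine ⟨n, s, List.ofFn fun q => List.ofFn fun x => (A.step x q : ℕ),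
    List.ofFn fun q => List.ofFn fun x => (ψ.transducer.out x q : ℕ),
    List.ofFn fun q => (ψ.vertex q : ℕ),
    List.ofFn fun p => List.ofFn fun q => r₁ (p, q),
    List.ofFn fun p => List.ofFn fun q => r₂ (p, q),
    List.ofFn fun p => List.ofFn fun q => r₃ (p, q),
    ⟨rfl, Fin.pos_iff_nonempty.2 this, by simp, by simp, by simp⟩, ?_, ?_, ?_, ?_, ?_, ?_, ?_, ?_⟩
  · intro q hq
    lift q to Fin s using hq
    rw [hv']
    simp
    rfl
  · intro q hq x hx
    lift q to Fin s using hq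
    lift x to Fin n using hx
    rw [hA', hB', hv', hA', hv', ψ.step_out]
    exact ⟨Fin.is_lt _, Fin.is_lt _, rfl⟩
  · intro p hp q hq h
    lift p to Fin s using hp
    lift q to Fin s using hq
    rw [hv', hv'] at h
    exact congrArg _ (ψ.vertex.injective (Fin.ext h))
  · intro q hq x hx y hy h
    lift q to Fin s using hq
    lift x to Fin n using hx
    lift y to Fin n using hy
    rw [hB', hB'] at h
    have := hedge ((ψ.edge_eq q x).trans ((congrArg _ (Fin.ext h)).trans (ψ.edge_eq q y).symm))
    exact congrArg (fun z : Fin s × Fin n => (z.2 : ℕ)) this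
  · intro q hq
    lift q to Fin s using hq
    obtain ⟨p, x, h⟩ := hcore q
    exact ⟨p, p.2, x, x.2, by rw [hA', h]⟩
  · intro p hp q hq
    lift p to Fin s using hp
    lift q to Fin s using hq
    rw [h₁]
    refine ⟨fun h => congrArg _ ((hr₁ _).1 h), fun x hx => ?_⟩
    lift x to Fin n using hx
    rw [hA', hA', h₁]
    exact (hr₁ (p, q)).2 x
  · intro p hp q hq
    lift p to Fin m using hp
    lift q to Fin s using hq
    rw [h₂]
    refine ⟨fun h x hx => ?_, fun x hx => ?_⟩
    · lift x to Fin n using hx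
      rw [hB']
      exact (hO' p x).trans (congrArg _ ((hr₂ _).1 h x))
    · lift x to Fin n using hx
      have hSx : tableEntry T.code.2.2.1 p x = T.step x p := hS' p x
      rw [hA', hSx, h₂]
      exact (hr₂ (p, q)).2 x
  · intro p hp q hq hpq
    lift p to Fin s using hp
    lift q to Fin s using hq
    rw [hv', hv', h₃, h₃]
    obtain ⟨x, h⟩ | h | ⟨x, h, h'⟩ := hr₃ (p, q) (fun e => hpq (congrArg _ e))
    · exact Or.inl ⟨x, x.2, by rw [hB', hB']; exact fun e => h (Fin.ext e)⟩
    · exact Or.inr (Or.inl h)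
    · refine Or.inr (Or.inr ⟨x, x.2, ?_⟩)
      rw [hA', hA', h₃]
      exact ⟨fun e => h (Fin.ext e), h'⟩

/-- The search for a certificate. -/
theorem exists_partrec_search : ∃ f : TransducerCode →. TransducerCode × List ℕ, Partrec f ∧
    ∀ (n : ℕ), 1 ≤ n → ∀ (Q : Type v) [Finite Q] (H : Transducer (Fin n) Q),
      IsHn H → H.FiniteOrder →
        ∀ (m : ℕ) (T : Transducer (Fin n) (Fin m)), SameMap T H →
          ∃ (s : ℕ) (A : Automaton (Fin n) (Fin s)) (ψ : DigraphAut A)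
            (φ : DigraphAut H.dualAutomaton),
            f T.code = Part.some ψ.code ∧ H.IsDualAction φ ∧ ψ.Iso φ := by
  classical
  let C : TransducerCode → CertificateCode → Prop := fun a c =>
    IsCertificate a.1 a.2.1 a.2.2.1 a.2.2.2 c.1.1.1 c.1.1.2.1 c.1.1.2.2.1
      c.1.1.2.2.2 c.1.2 c.2.1 c.2.2.1 c.2.2.2
  have hC : PrimrecPred fun z : TransducerCode × CertificateCode => C z.1 z.2 :=
    primrecPred_isCertificate
  -- All certificate codes are enumerated, and the ranks are dropped from the first valid one. Which
  -- one comes first is irrelevant, since each describes the same object up to isomorphism.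
  let search : TransducerCode → ℕ → Option (TransducerCode × List ℕ) := fun a k =>
    (Encodable.decode (α := CertificateCode) k).bind fun c => if C a c then some c.1 else none
  have hsearch : Primrec₂ search :=
    Primrec.option_bind (Primrec.decode.comp Primrec.snd)
      (Primrec.ite (hC.comp ((Primrec.fst.comp Primrec.fst).pair Primrec.snd))
        (Primrec.option_some.comp (Primrec.fst.comp Primrec.snd)) (Primrec.const none))
  refine ⟨fun a => Nat.rfindOpt (search a), Partrec.rfindOpt hsearch.to_comp, ?_⟩
  intro n hn Q _ H hH hfin m T hT
  have hdom : (Nat.rfindOpt (search T.code)).Dom := by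
    obtain ⟨n', s, tA, tB, v, r₁, r₂, r₃, h⟩ := exists_isCertificate hn hH hfin hT
    refine Nat.rfindOpt_dom.2 ⟨Encodable.encode
      ((((n', s, tA, tB), v), r₁, r₂, r₃) : CertificateCode), ((n', s, tA, tB), v), ?_⟩
    have h' : C T.code (((n', s, tA, tB), v), r₁, r₂, r₃) := h
    simp only [search, Encodable.encodek, Option.bind_some, if_pos h']
    rfl
  obtain ⟨k, hk⟩ := Nat.rfindOpt_spec (Part.get_mem hdom)
  obtain ⟨c, -, hc⟩ := Option.mem_bind_iff.1 hk
  have hCc : C T.code c := by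
    by_contra h0
    rw [if_neg h0] at hc
    cases hc
  rw [if_pos hCc] at hc
  obtain ⟨A, ψ, φ, hcode, hact, hiso⟩ := IsCertificate.exists_iso hn hH hfin hT hCc
  refine ⟨_, A, ψ, φ, ?_, hact, hiso⟩
  rw [← hcode, Part.eq_some_iff]
  have := Part.get_mem hdom
  rwa [← Option.mem_some_iff.1 hc] at this

end Algorithm

theorem proposition3p5 :
    -- the automaton, its automorphism, and its minimality
    (∀ (n : ℕ), 1 ≤ n → ∀ (Q : Type u) [Finite Q] (H : Transducer (Fin n) Q),
      IsHn H → H.FiniteOrder →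
        IsLeast {k | H.IsZeroLevel k} H.zeroLevel ∧
        (∀ (γ : Word (Fin n) H.zeroLevel) (x : Fin n),
          H.dualAutomaton.step x (H.cls γ) = H.cls (Word.push γ x)) ∧
        (∃ φ : DigraphAut H.dualAutomaton, H.IsDualAction φ ∧
          ∀ ψ : DigraphAut H.dualAutomaton, InducedFrom H ψ ↔ ψ = φ) ∧
        IsMinimalSupport H.dualAutomaton H ∧
        (∀ (S : Type v) [Finite S] (A : Automaton (Fin n) S),
          IsMinimalSupport A H → A.Iso H.dualAutomaton) ∧
        (∀ (S : Type v) [Finite S] (A : Automaton (Fin n) S),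
          Supports A H → A.FoldsOnto H.dualAutomaton)) ∧
    -- every automorphism of finite order of the shift is represented in this way
    (∀ (n : ℕ), 1 ≤ n → ∀ φ : (ℕ → Fin n) ≃ₜ (ℕ → Fin n),
      (∀ x, φ (shiftMap x) = shiftMap (φ x)) → IsOfFinOrder φ →
        ∃ (m : ℕ) (H : Transducer (Fin n) (Fin m)), IsHn H ∧ H.FiniteOrder ∧ H.Induces φ) ∧
    -- one algorithm finds the automaton and the automorphism from any representing transducer
    (∃ f : ℕ × ℕ × List (List ℕ) × List (List ℕ) →.
        (ℕ × ℕ × List (List ℕ) × List (List ℕ)) × List ℕ, Partrec f ∧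
      ∀ (n : ℕ), 1 ≤ n → ∀ (Q : Type u) [Finite Q] (H : Transducer (Fin n) Q),
        IsHn H → H.FiniteOrder →
          ∀ (m : ℕ) (T : Transducer (Fin n) (Fin m)), SameMap T H →
            ∃ (s : ℕ) (A : Automaton (Fin n) (Fin s)) (ψ : DigraphAut A)
              (φ : DigraphAut H.dualAutomaton),
              f T.code = Part.some ψ.code ∧ H.IsDualAction φ ∧ ψ.Iso φ) := ⟨fun _ hn _ _ _ hH hfin => dualAutomaton_minimal_support hn hH hfin,
    fun _ hn φ hφ hfin => exists_isHn_of_homeomorph hn φ hφ hfin, exists_partrec_search⟩
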